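/- Let \(p>3\) be a prime, \(\mathcal{E}\) an elliptic curve over \(\mathbb{F}_{p^2}\), and \({}^{\sigma}\mathcal{E}\) the Galois conjugate curve, obtained by applying \(\sigma: x\mapsto x^p\) to the coefficients of \(\mathcal{E}\). Let \(\pi_p:\mathcal{E}\to{}^{\sigma}\mathcal{E}\), \((x,y)\mapsto(x^p,y^p)\), and let \(\pi_{p^2}\in\mathrm{End}(\mathcal{E})\), \((x,y)\mapsto(x^{p^2},y^{p^2})\), be the Frobenius endomorphism. For an endomorphism \(\alpha\) of \(\mathcal{E}\), let \(\chi_\alpha(T)=T^2-\mathrm{tr}(\alpha)T+\deg(\alpha)\), with \(\mathrm{tr}(\alpha)=1+\deg(\alpha)-\deg(1-\alpha)\), be its characteristic polynomial, and write \(t_{\mathcal{E}}=\mathrm{tr}(\pi_{p^2})\) for the trace of Frobenius. Let \(d\) be a squarefree positive integer with \(p\nmid d\), and suppose that \(\mathcal{E}\) is \(d\)-admissible, that is, equipped with an isogeny \(\phi:\mathcal{E}\to{}^{\sigma}\mathcal{E}\) of degree \(d\) defined over \(\mathbb{F}_{p^2}\) whose Galois conjugate \({}^{\sigma}\phi:{}^{\sigma}\mathcal{E}\to\mathcal{E}\)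 satisfies \({}^{\sigma}\phi=\epsilon\hat{\phi}\) with \(\epsilon\in\{1,-1\}\), where \(\hat\phi\) is the dual isogeny of \(\phi\). Then the associated map \(\psi:={}^{\sigma}\phi\circ\pi_p\) is an endomorphism of \(\mathcal{E}\) (an isogeny over \(\mathbb{F}_{p^2}\)) such that \[ \psi^2=[\epsilon d]\,\pi_{p^2}\quad\text{in } \mathrm{End}(\mathcal{E}), \] and there is an integer \(r\) such that the characteristic polynomial of \(\psi\) is \[ \chi_\psi(T)=T^2-rd\,T+dp,\qquad\text{with}\qquad dr^2=2p+\epsilon t_{\mathcal{E}}, \] and \[ r\psi=p+\epsilon\pi_{p^2}\quad\text{in }\mathrm{End}(\mathcal{E}). \] -/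

import Mathlib

open Polynomial
open scoped Polynomial.Bivariate

noncomputable section

namespace EllipticIsogeny

instance instDecidableEqAlgebraicClosure (F : Type*) [Field F] :
    DecidableEq (AlgebraicClosure F) := Classical.decEq _

/-- The base change of a Weierstrass curve over `F` to the algebraic closure of `F`. -/
abbrev geomCurve {F : Type*} [Field F] (E : WeierstrassCurve F) :
    WeierstrassCurve.Affine (AlgebraicClosure F) :=
  (E.map (algebraMap F (AlgebraicClosure F))).toAffine

/-- The group `E(F̄)` of geometric points of `E`. -/
abbrev GeomPoint {F : Type*} [Field F] (E : WeierstrassCurve F) : Type _ :=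
  (geomCurve E).Point

/-! ### Isogenies over the base field and their degrees -/

/-- The homomorphism `α : E₁(F̄) → E₂(F̄)` is given by the pair `(u, v)` of rational functions on
`E₁` over `F`: one can write `u = a / b` and `v = c / b` in `F(E₁)` with polynomials
`a, b, c ∈ F[X, Y]`, where `b` does not vanish identically on `E₁`, such that
`α (x, y) = (a (x, y) / b (x, y), c (x, y) / b (x, y))` for all affine geometric points
`(x, y)` of `E₁` with `b (x, y) ≠ 0`. -/
def IsGivenBy {F : Type*} [Field F] {E₁ E₂ : WeierstrassCurve F}
    (α : GeomPoint E₁ →+ GeomPoint E₂) (u v : E₁.toAffine.FunctionField) : Prop :=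
  ∃ a b c : F[X][Y],
    WeierstrassCurve.Affine.CoordinateRing.mk E₁.toAffine b ≠ 0 ∧
    u = algebraMap E₁.toAffine.CoordinateRing E₁.toAffine.FunctionField
          (WeierstrassCurve.Affine.CoordinateRing.mk E₁.toAffine a) /
        algebraMap E₁.toAffine.CoordinateRing E₁.toAffine.FunctionField
          (WeierstrassCurve.Affine.CoordinateRing.mk E₁.toAffine b) ∧
    v = algebraMap E₁.toAffine.CoordinateRing E₁.toAffine.FunctionField
          (WeierstrassCurve.Affine.CoordinateRing.mk E₁.toAffine c) /
        algebraMap E₁.toAffine.CoordinateRing E₁.toAffine.FunctionField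
          (WeierstrassCurve.Affine.CoordinateRing.mk E₁.toAffine b) ∧
    ∀ (x y : AlgebraicClosure F) (h : (geomCurve E₁).Nonsingular x y),
      aevalAeval x y b ≠ 0 →
      ∃ h' : (geomCurve E₂).Nonsingular (aevalAeval x y a / aevalAeval x y b)
          (aevalAeval x y c / aevalAeval x y b),
        α (.some x y h) = .some _ _ h'

/-- An isogeny over `F`: a homomorphism of groups of geometric points that is given by rational
functions over `F`. In particular it is not the zero map. -/
def IsIsogeny {F : Type*} [Field F] {E₁ E₂ : WeierstrassCurve F}
    (α : GeomPoint E₁ →+ GeomPoint E₂) : Prop :=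
  ∃ u v : E₁.toAffine.FunctionField, IsGivenBy α u v

/-- The pullback `α^* F(E₂) ⊆ F(E₁)` of the function field of `E₂`: it is generated over `F` by the
two rational functions which give `α`. For the zero map it is `F`. -/
def pullbackField {F : Type*} [Field F] {E₁ E₂ : WeierstrassCurve F}
    (α : GeomPoint E₁ →+ GeomPoint E₂) : IntermediateField F E₁.toAffine.FunctionField :=
  IntermediateField.adjoin F {w | ∃ u v, IsGivenBy α u v ∧ (w = u ∨ w = v)}

/-- The degree `[F(E₁) : α^* F(E₂)]` of an isogeny. The zero map gets degree `0`, since `F(E₁)` has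
infinite degree over `F`. -/
def degree {F : Type*} [Field F] {E₁ E₂ : WeierstrassCurve F}
    (α : GeomPoint E₁ →+ GeomPoint E₂) : ℕ :=
  Module.finrank (pullbackField α) E₁.toAffine.FunctionField

/-- `β` is the dual isogeny of the isogeny `α`. -/
def IsDual {F : Type*} [Field F] {E₁ E₂ : WeierstrassCurve F}
    (α : GeomPoint E₁ →+ GeomPoint E₂) (β : GeomPoint E₂ →+ GeomPoint E₁) : Prop :=
  IsIsogeny α ∧ IsIsogeny β ∧
    (∀ P, β (α P) = degree α • P) ∧ ∀ Q, α (β Q) = degree α • Q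

/-- The trace of an endomorphism. -/
def trace {F : Type*} [Field F] {E : WeierstrassCurve F} (α : AddMonoid.End (GeomPoint E)) : ℤ :=
  1 + (degree α : ℤ) - (degree (1 - α : AddMonoid.End (GeomPoint E)) : ℤ)

/-- The characteristic polynomial `T² - tr(α) T + deg(α)` of an endomorphism. -/
def charpoly {F : Type*} [Field F] {E : WeierstrassCurve F} (α : AddMonoid.End (GeomPoint E)) :
    ℤ[X] :=
  X ^ 2 - C (trace α) * X + C (degree α : ℤ)

/-! ### Frobenius maps and Galois conjugation -/

/-- The map `(x, y) ↦ (f x, f y)` on points induced by a homomorphism `f` of fields. -/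
def pointMap {L M : Type*} [Field L] [Field M] [DecidableEq L] [DecidableEq M] (f : L →+* M)
    {W₁ : WeierstrassCurve.Affine L} {W₂ : WeierstrassCurve.Affine M} (h : W₁.map f = W₂) :
    W₁.Point →+ W₂.Point where
  toFun P := match P with
    | .zero => .zero
    | .some x y hxy => .some (f x) (f y) (h ▸ (W₁.map_nonsingular f.injective x y).mpr hxy)
  map_zero' := rfl
  map_add' := by
    subst h
    let _ := f.toAlgebra
    let g := WeierstrassCurve.Affine.Point.map (W' := W₁) (S := L) (Algebra.ofId L M)
    intro P Q
    refine Eq.trans (b := g (P + Q)) ?_ ((g.map_add P Q).trans (congrArg₂ _ ?_ ?_))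
    · generalize P + Q = R
      cases R <;> rfl
    · cases P <;> rfl
    · cases Q <;> rfl

section Frobenius

variable (p : ℕ) [Fact p.Prime] {F : Type*} [Field F] [CharP F p]

instance instCharPAlgebraicClosure : CharP (AlgebraicClosure F) p :=
  charP_of_injective_algebraMap (algebraMap F (AlgebraicClosure F)).injective p

/-- The Galois conjugate curve `σE`, with `σ : x ↦ x ^ p` applied to the coefficients of `E`. -/
abbrev conjCurve (E : WeierstrassCurve F) : WeierstrassCurve F :=
  E.map (frobenius F p)

theorem geomCurve_map_frobenius {E E' : WeierstrassCurve F} (h : conjCurve p E = E') :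
    (geomCurve E).map (frobenius (AlgebraicClosure F) p) = geomCurve E' := by
  subst h
  ext <;> simp [geomCurve, frobenius_def]

theorem geomCurve_map_frobenius_symm {E E' : WeierstrassCurve F} (h : conjCurve p E = E') :
    (geomCurve E').map ((frobeniusEquiv (AlgebraicClosure F) p).symm : _ →+* _) = geomCurve E := by
  rw [← geomCurve_map_frobenius p h]
  have key (x : AlgebraicClosure F) :
      (frobeniusEquiv (AlgebraicClosure F) p).symm (x ^ p) = x :=
    (frobeniusEquiv (AlgebraicClosure F) p).symm_apply_apply x
  ext <;> simp [frobenius_def, key]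

theorem conjCurve_conjCurve (hF : Nat.card F = p ^ 2) (E : WeierstrassCurve F) :
    conjCurve p (conjCurve p E) = E := by
  have hp : p ^ 2 ≠ 0 := pow_ne_zero _ (Fact.out : p.Prime).ne_zero
  have : Finite F := Nat.finite_of_card_ne_zero (hF ▸ hp)
  let _ := Fintype.ofFinite F
  have key (x : F) : (x ^ p) ^ p = x := by
    rw [← pow_mul, ← sq, ← hF, Nat.card_eq_fintype_card, FiniteField.pow_card]
  ext <;> simp [frobenius_def, key]

theorem geomCurve_map_iterateFrobenius (hF : Nat.card F = p ^ 2) (E : WeierstrassCurve F) :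
    (geomCurve E).map (iterateFrobenius (AlgebraicClosure F) p 2) = geomCurve E := by
  refine Eq.trans ?_ (geomCurve_map_frobenius p (conjCurve_conjCurve p hF E))
  rw [← geomCurve_map_frobenius p (E := E) rfl]
  ext <;> simp [iterateFrobenius_def, frobenius_def, pow_two, pow_mul]

/-- The `p`-power Frobenius isogeny `π_p : E → σE`, `(x, y) ↦ (x ^ p, y ^ p)`. -/
def frobeniusIsogeny {E E' : WeierstrassCurve F} (h : conjCurve p E = E') :
    GeomPoint E →+ GeomPoint E' :=
  pointMap (frobenius (AlgebraicClosure F) p) (geomCurve_map_frobenius p h)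

/-- The Frobenius endomorphism `π_q : E → E`, `(x, y) ↦ (x ^ q, y ^ q)`, where `q = p ^ 2` is the
number of elements of `F`. -/
def frobeniusEnd (hF : Nat.card F = p ^ 2) (E : WeierstrassCurve F) :
    AddMonoid.End (GeomPoint E) :=
  pointMap (iterateFrobenius (AlgebraicClosure F) p 2) (geomCurve_map_iterateFrobenius p hF E)

/-- The Galois conjugate `σα : σE₁ → σE₂` of `α : E₁ → E₂`: as a map on geometric points it is
`P ↦ σ (α (σ⁻¹ P))`, where `σ` is the automorphism `x ↦ x ^ p` of the algebraic closure of `F`. If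
`α` is given by rational functions, then `σα` is given by the rational functions obtained by
applying `σ` to their coefficients. -/
def galoisConj {E₁ E₁' E₂ E₂' : WeierstrassCurve F}
    (h₁ : conjCurve p E₁ = E₁') (h₂ : conjCurve p E₂ = E₂')
    (α : GeomPoint E₁ →+ GeomPoint E₂) : GeomPoint E₁' →+ GeomPoint E₂' :=
  (pointMap (frobenius (AlgebraicClosure F) p) (geomCurve_map_frobenius p h₂)).comp
    (α.comp (pointMap ((frobeniusEquiv (AlgebraicClosure F) p).symm : _ →+* _)
      (geomCurve_map_frobenius_symm p h₁)))

/-- The Galois conjugate `σφ : σE → σσE = E` of `φ : E → σE`, for `E` over a field of `p ^ 2`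
elements. -/
def conjIsogeny (hF : Nat.card F = p ^ 2) {E : WeierstrassCurve F}
    (φ : GeomPoint E →+ GeomPoint (conjCurve p E)) : GeomPoint (conjCurve p E) →+ GeomPoint E :=
  galoisConj p rfl (conjCurve_conjCurve p hF E) φ

/-- `E`, equipped with `φ : E → σE` and the sign `ε`, is a `d`-admissible curve over the field `F`
of `p ^ 2` elements. -/
structure IsAdmissible (hF : Nat.card F = p ^ 2) (E : WeierstrassCurve F) (d : ℕ)
    (φ : GeomPoint E →+ GeomPoint (conjCurve p E)) (ε : ℤ) : Prop where
  squarefree : Squarefree d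
  not_dvd : ¬ p ∣ d
  isIsogeny : IsIsogeny φ
  degree_eq : degree φ = d
  sign : ε = 1 ∨ ε = -1
  conj_eq : ∃ φ', IsDual φ φ' ∧ conjIsogeny p hF φ = ε • φ'

/-- The associated endomorphism `ψ = σφ ∘ π_p`. -/
def associatedEnd (hF : Nat.card F = p ^ 2) {E : WeierstrassCurve F}
    (φ : GeomPoint E →+ GeomPoint (conjCurve p E)) : AddMonoid.End (GeomPoint E) :=
  (conjIsogeny p hF φ).comp (frobeniusIsogeny p rfl)

/-- The trace `t_E` of Frobenius. -/
def frobeniusTrace (hF : Nat.card F = p ^ 2) (E : WeierstrassCurve F) : ℤ :=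
  trace (frobeniusEnd p hF E)

end Frobenius

end EllipticIsogeny

end

open Polynomial
open scoped Polynomial.Bivariate

noncomputable section

namespace EllipticIsogeny

/-! Since `σφ = π_p ∘ φ ∘ π_p⁻¹` on geometric points, `ψ = π_p ∘ φ`, so `ψ` is an isogeny of degree
`d p`. Writing one factor of `ψ²` as `π_p ∘ φ` and the other as `ε φ' ∘ π_p`, with `φ'` the dual,
makes `φ ∘ φ' = d` appear in the middle and gives `ψ² = ε d π`, where `π = π_{p²}`.

The rest is arithmetic in the ring of endomorphisms over `F`. Cayley–Hamilton, `ψ² = tψ - dp`, turns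
the first identity into `tψ = d(p + επ)`. Taking degrees, `t² p = d · deg(p + επ)`; as `d` is
squarefree and prime to `p`, it divides `t`, say `t = rd`, and cancelling `d` leaves `rψ = p + επ`.
Squaring this and using `π² = t_E π - p²` yields `d r² = 2p + ε t_E`. This is
`IsQuadraticNorm.exists_trace_eq`.

Cayley–Hamilton (`IsQuadraticNorm.mul_self_eq`) is formal once the degree is multiplicative, obeys
the parallelogram law, is `1` at the identity and vanishes only at zero. Multiplicativity is the
tower law for function fields (`degree_comp`). For the parallelogram law
(`IsRegular.degree_add_add_degree_sub`), the `x`-coordinate of an isogeny is a rational function of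
`x` whose degree is the degree of the isogeny, and `{x(P), x(Q)} ↦ {x(P + Q), x(P - Q)}` is given by
quadratic forms without common zero. Such forms double degrees.

Rational functions and homomorphisms are compared through their values at all but finitely many
geometric points, expressed with the filter `cofinite`. -/

open Filter WeierstrassCurve WeierstrassCurve.Affine

/-! ### Values of rational functions at almost all geometric points. -/

section Evaluation

variable {F : Type*} [Field F] {E : WeierstrassCurve F}

/-- The `x`-coordinate of a geometric point, with value `0` at the point at infinity. -/
def xc : GeomPoint E → AlgebraicClosure F
  | .zero => 0
  | .some x _ _ => x

/-- The `y`-coordinate of a geometric point, with value `0` at the point at infinity. -/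
def yc : GeomPoint E → AlgebraicClosure F
  | .zero => 0
  | .some _ y _ => y

/-- The value of a polynomial in the coordinates at a geometric point. -/
abbrev pe (P : GeomPoint E) : F[X][Y] →ₐ[F] AlgebraicClosure F :=
  aevalAeval (xc P) (yc P)

@[simp] lemma xc_some {x y : AlgebraicClosure F} (h : (geomCurve E).Nonsingular x y) :
    xc (.some x y h : GeomPoint E) = x := rfl

@[simp] lemma yc_some {x y : AlgebraicClosure F} (h : (geomCurve E).Nonsingular x y) :
    yc (.some x y h : GeomPoint E) = y := rfl

lemma nonsingular_of_ne_zero {P : GeomPoint E} (hP : P ≠ 0) :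
    (geomCurve E).Nonsingular (xc P) (yc P) := by
  cases P with
  | zero => exact absurd rfl hP
  | some x y h => exact h

lemma eq_some_of_ne_zero {P : GeomPoint E} (hP : P ≠ 0) :
    P = .some (xc P) (yc P) (nonsingular_of_ne_zero hP) := by
  cases P with
  | zero => exact absurd rfl hP
  | some x y h => rfl

lemma equation_of_ne_zero {P : GeomPoint E} (hP : P ≠ 0) :
    (geomCurve E).Equation (xc P) (yc P) := (nonsingular_of_ne_zero hP).1

lemma pe_polynomial {P : GeomPoint E} (hP : P ≠ 0) : pe P E.toAffine.polynomial = 0 := by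
  have h := (equation_iff' _ _).1 (equation_of_ne_zero hP)
  simp only [geomCurve, toAffine, map_a₁, map_a₂, map_a₃, map_a₄, map_a₆] at h
  rw [WeierstrassCurve.Affine.polynomial]
  simp only [map_sub, map_add, map_mul, map_pow, aevalAeval_Y, aevalAeval_C, aeval_X, aeval_C]
  linear_combination h

lemma pe_eq_of_mk_eq {P : GeomPoint E} (hP : P ≠ 0) {f g : F[X][Y]}
    (h : CoordinateRing.mk E.toAffine f = CoordinateRing.mk E.toAffine g) : pe P f = pe P g := by
  obtain ⟨c, hc⟩ := AdjoinRoot.mk_eq_mk.1 h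
  rw [← sub_eq_zero, ← map_sub, hc, map_mul, pe_polynomial hP, zero_mul]

lemma finite_xc_preimage {S : Set (AlgebraicClosure F)} (hS : S.Finite) :
    {P : GeomPoint E | xc P ∈ S}.Finite := by
  refine Set.Finite.preimage' hS fun x _ ↦ ?_
  by_cases h : ∃ Q : GeomPoint E, Q ≠ 0 ∧ xc Q = x
  · obtain ⟨Q, hQ0, hQ⟩ := h
    -- The point at infinity is listed because `xc` gives it the default value `0`.
    refine (Set.toFinite {0, Q, -Q}).subset fun P hP ↦ ?_
    by_cases hP0 : P = 0
    · simp [hP0]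
    · have := (Point.X_eq_iff (h₁ := nonsingular_of_ne_zero hP0)
        (h₂ := nonsingular_of_ne_zero hQ0)).1 (by rw [hQ]; exact hP)
      rw [← eq_some_of_ne_zero hP0, ← eq_some_of_ne_zero hQ0] at this
      rcases this with rfl | rfl <;> simp
  · refine (Set.toFinite {0}).subset fun P hP ↦ ?_
    by_contra hP0
    exact h ⟨P, hP0, hP⟩

lemma eventually_ne_zero : ∀ᶠ P : GeomPoint E in cofinite, P ≠ 0 :=
  (Set.finite_singleton _).eventually_cofinite_notMem

lemma eventually_aeval_xc_ne_zero {f : F[X]} (hf : f ≠ 0) :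
    ∀ᶠ P : GeomPoint E in cofinite, aeval (xc P) f ≠ 0 := by
  refine (finite_xc_preimage (E := E) (f.rootSet_finite (AlgebraicClosure F))).subset
    fun P hP ↦ ?_
  simpa [mem_rootSet, hf] using hP

/-- The norm of `g` down to `F[X]` is a nonzero polynomial in `x` and a multiple of `g`, so the
affine zeros of `g` lie above its finitely many roots. -/
lemma eventually_pe_ne_zero {g : F[X][Y]} (hg : CoordinateRing.mk E.toAffine g ≠ 0) :
    ∀ᶠ P : GeomPoint E in cofinite, pe P g ≠ 0 := by
  obtain ⟨p, q, hpq⟩ := CoordinateRing.exists_smul_basis_eq (CoordinateRing.mk E.toAffine g)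
  have hN : Algebra.norm F[X] (p • (1 : E.toAffine.CoordinateRing) +
      q • CoordinateRing.mk E.toAffine Y) ≠ 0 := by
    rw [hpq]
    intro h0
    exact hg ((Algebra.norm_eq_zero_iff_of_basis (CoordinateRing.basis E.toAffine)).1 h0)
  filter_upwards [eventually_aeval_xc_ne_zero (E := E) hN, eventually_ne_zero] with P hP hP0 h0
  apply hP
  have h1 := CoordinateRing.coe_norm_smul_basis (W' := E.toAffine) p q
  have h2 : CoordinateRing.mk E.toAffine g = CoordinateRing.mk E.toAffine (C p + C q * Y) := by
    rw [← hpq, CoordinateRing.smul, CoordinateRing.smul, map_add, map_mul, mul_one]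
  rw [pe_eq_of_mk_eq hP0 h2] at h0
  have h3 : pe P (C (Algebra.norm F[X] (p • (1 : E.toAffine.CoordinateRing) +
      q • CoordinateRing.mk E.toAffine Y))) = pe P _ := pe_eq_of_mk_eq hP0 h1
  rw [map_mul, h0, zero_mul, aevalAeval_C] at h3
  exact h3

lemma exists_xc_eq [E.IsElliptic] (x : AlgebraicClosure F) :
    ∃ P : GeomPoint E, P ≠ 0 ∧ xc P = x := by
  let W := geomCurve E
  obtain ⟨y, hy⟩ := IsAlgClosed.exists_root (C 1 * X ^ 2 + C (W.a₁ * x + W.a₃) * X +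
    C (-(x ^ 3 + W.a₂ * x ^ 2 + W.a₄ * x + W.a₆))) (by
      rw [degree_quadratic one_ne_zero]; norm_num)
  have : (geomCurve E).Equation x y := by
    rw [equation_iff']
    simp only [IsRoot, eval_add, eval_mul, eval_C, eval_pow, eval_X] at hy
    linear_combination hy
  exact ⟨.some x y ((geomCurve E).equation_iff_nonsingular.1 this), Point.some_ne_zero _, rfl⟩

/-- Makes `cofinite` a proper filter, so that a property of almost all points has a witness. -/
instance [E.IsElliptic] : Infinite (GeomPoint E) :=
  Infinite.of_surjective (xc (E := E)) fun x ↦ (exists_xc_eq x).imp fun _ h ↦ h.2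

variable (E) in
/-- The rational function on `E` defined by a polynomial in the coordinates. -/
def polyFF : F[X][Y] →+* E.toAffine.FunctionField :=
  (algebraMap E.toAffine.CoordinateRing E.toAffine.FunctionField).comp
    (CoordinateRing.mk E.toAffine)

lemma polyFF_ne_zero {g : F[X][Y]} :
    polyFF E g ≠ 0 ↔ CoordinateRing.mk E.toAffine g ≠ 0 := by
  rw [polyFF, RingHom.comp_apply, ne_eq, ne_eq,
    IsFractionRing.to_map_eq_zero_iff]

lemma pe_eq_of_polyFF_eq {P : GeomPoint E} (hP : P ≠ 0) {f g : F[X][Y]}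
    (h : polyFF E f = polyFF E g) : pe P f = pe P g :=
  pe_eq_of_mk_eq hP (IsFractionRing.injective E.toAffine.CoordinateRing
    E.toAffine.FunctionField h)

lemma eventually_pe_ne_zero' {g : F[X][Y]} (hg : polyFF E g ≠ 0) :
    ∀ᶠ P : GeomPoint E in cofinite, pe P g ≠ 0 :=
  eventually_pe_ne_zero (polyFF_ne_zero.1 hg)

lemma exists_eq_polyFF_div (u : E.toAffine.FunctionField) :
    ∃ a b : F[X][Y], polyFF E b ≠ 0 ∧ u = polyFF E a / polyFF E b := by
  obtain ⟨a, b, hb, rfl⟩ := IsFractionRing.div_surjective (A := E.toAffine.CoordinateRing) u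
  obtain ⟨a, rfl⟩ := AdjoinRoot.mk_surjective a
  obtain ⟨b, rfl⟩ := AdjoinRoot.mk_surjective b
  exact ⟨a, b, polyFF_ne_zero.2 (nonZeroDivisors.ne_zero hb), rfl⟩

lemma algebraMap_eq_polyFF (c : F) :
    algebraMap F E.toAffine.FunctionField c = polyFF E (C (C c)) := rfl

/-- The value of a rational function at a geometric point, meaningful for all but finitely many
points. -/
def val (u : E.toAffine.FunctionField) (P : GeomPoint E) : AlgebraicClosure F :=
  pe P (exists_eq_polyFF_div u).choose / pe P (exists_eq_polyFF_div u).choose_spec.choose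

/-- The fraction chosen in `val` does not matter: cross-multiplied equality in the coordinate ring
can be evaluated at any affine point. -/
lemma eventually_val_div (a : F[X][Y]) {b : F[X][Y]} (hb : polyFF E b ≠ 0) :
    ∀ᶠ P : GeomPoint E in cofinite, val (polyFF E a / polyFF E b) P = pe P a / pe P b := by
  have h := (exists_eq_polyFF_div (polyFF E a / polyFF E b)).choose_spec.choose_spec
  simp only [val]
  set a' := (exists_eq_polyFF_div (polyFF E a / polyFF E b)).choose
  set b' := (exists_eq_polyFF_div (polyFF E a / polyFF E b)).choose_spec.choose
  filter_upwards [eventually_pe_ne_zero' hb, eventually_pe_ne_zero' h.1, eventually_ne_zero]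
    with P h1 h2 hP
  rw [div_eq_div_iff h2 h1, ← map_mul, ← map_mul]
  apply pe_eq_of_polyFF_eq hP
  rw [map_mul, map_mul, ← div_eq_div_iff h.1 hb]
  exact h.2.symm

lemma eventually_val_polyFF (a : F[X][Y]) :
    ∀ᶠ P : GeomPoint E in cofinite, val (polyFF E a) P = pe P a := by
  simpa using eventually_val_div (E := E) a (b := 1) (by simp)

lemma eventually_val_algebraMap (c : F) : ∀ᶠ P : GeomPoint E in cofinite,
    val (algebraMap F E.toAffine.FunctionField c) P = algebraMap F _ c := by
  filter_upwards [eventually_val_polyFF (E := E) (C (C c))] with P hP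
  rw [algebraMap_eq_polyFF, hP, aevalAeval_C, aeval_C]

lemma eventually_val_add (u v : E.toAffine.FunctionField) :
    ∀ᶠ P in cofinite, val (u + v) P = val u P + val v P := by
  obtain ⟨a, b, hb, rfl⟩ := exists_eq_polyFF_div u
  obtain ⟨c, d, hd, rfl⟩ := exists_eq_polyFF_div v
  have h := eventually_val_div (E := E) (a * d + b * c) (b := b * d)
    (by rw [map_mul]; exact mul_ne_zero hb hd)
  rw [map_add, map_mul, map_mul, map_mul, ← div_add_div _ _ hb hd] at h
  filter_upwards [h, eventually_val_div a hb, eventually_val_div c hd,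
    eventually_pe_ne_zero' hb, eventually_pe_ne_zero' hd] with P h1 h2 h3 h4 h5
  rw [h1, h2, h3, div_add_div _ _ h4 h5, map_add, map_mul, map_mul, map_mul]

lemma eventually_val_mul (u v : E.toAffine.FunctionField) :
    ∀ᶠ P in cofinite, val (u * v) P = val u P * val v P := by
  obtain ⟨a, b, hb, rfl⟩ := exists_eq_polyFF_div u
  obtain ⟨c, d, hd, rfl⟩ := exists_eq_polyFF_div v
  have h := eventually_val_div (E := E) (a * c) (b := b * d)
    (by rw [map_mul]; exact mul_ne_zero hb hd)
  rw [map_mul, map_mul, ← div_mul_div_comm] at h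
  filter_upwards [h, eventually_val_div a hb, eventually_val_div c hd] with P h1 h2 h3
  rw [h1, h2, h3, div_mul_div_comm, map_mul, map_mul]

lemma eventually_val_zero : ∀ᶠ P in cofinite, val (0 : E.toAffine.FunctionField) P = 0 := by
  simpa using eventually_val_algebraMap (E := E) 0

lemma eventually_val_one : ∀ᶠ P in cofinite, val (1 : E.toAffine.FunctionField) P = 1 := by
  simpa using eventually_val_algebraMap (E := E) 1

lemma eventually_val_neg (u : E.toAffine.FunctionField) :
    ∀ᶠ P in cofinite, val (-u) P = -val u P := by
  filter_upwards [eventually_val_add u (-u), eventually_val_zero] with P h1 h2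
  rw [add_neg_cancel, h2] at h1
  exact eq_neg_of_add_eq_zero_right h1.symm

lemma eventually_val_sub (u v : E.toAffine.FunctionField) :
    ∀ᶠ P in cofinite, val (u - v) P = val u P - val v P := by
  filter_upwards [eventually_val_add u (-v), eventually_val_neg v] with P h1 h2
  rw [sub_eq_add_neg, h1, h2, sub_eq_add_neg]

lemma eventually_val_pow (u : E.toAffine.FunctionField) (n : ℕ) :
    ∀ᶠ P in cofinite, val (u ^ n) P = val u P ^ n := by
  induction n with
  | zero => simpa using eventually_val_one
  | succ n ih =>
    filter_upwards [ih, eventually_val_mul (u ^ n) u] with P h1 h2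
    rw [pow_succ, h2, h1, pow_succ]

lemma eventually_val_ne_zero {u : E.toAffine.FunctionField} (hu : u ≠ 0) :
    ∀ᶠ P in cofinite, val u P ≠ 0 := by
  filter_upwards [eventually_val_mul u u⁻¹, eventually_val_one] with P h1 h2 h3
  rw [mul_inv_cancel₀ hu, h2, h3, zero_mul] at h1
  exact one_ne_zero h1

lemma eventually_val_div' (u v : E.toAffine.FunctionField) (hv : v ≠ 0) :
    ∀ᶠ P in cofinite, val (u / v) P = val u P / val v P := by
  filter_upwards [eventually_val_mul (u / v) v, eventually_val_ne_zero hv] with P h1 h2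
  rw [div_mul_cancel₀ _ hv] at h1
  rw [h1, mul_div_cancel_right₀ _ h2]

lemma eventually_val_ne {u v : E.toAffine.FunctionField} (huv : u ≠ v) :
    ∀ᶠ P in cofinite, val u P ≠ val v P := by
  filter_upwards [eventually_val_sub u v, eventually_val_ne_zero (sub_ne_zero.2 huv)]
    with P h1 h2
  rwa [h1, sub_ne_zero] at h2

/-- The principle by which identities in the function field are checked pointwise: a nonzero
difference has nonzero values at almost all points. -/
lemma eq_of_eventually_val_eq [E.IsElliptic] {u v : E.toAffine.FunctionField}
    (h : ∀ᶠ P in cofinite, val u P = val v P) : u = v := by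
  by_contra huv
  obtain ⟨P, h1, h2⟩ := (h.and (eventually_val_ne huv)).exists
  exact h2 h1

lemma eventually_val_aeval (u : E.toAffine.FunctionField) (f : F[X]) :
    ∀ᶠ P in cofinite, val (aeval u f) P = aeval (val u P) f := by
  induction f using Polynomial.induction_on' with
  | add f g hf hg =>
    filter_upwards [hf, hg, eventually_val_add (aeval u f) (aeval u g)] with P h1 h2 h3
    rw [map_add, map_add, h3, h1, h2]
  | monomial n c =>
    filter_upwards [eventually_val_algebraMap c, eventually_val_pow u n,
      eventually_val_mul (algebraMap F E.toAffine.FunctionField c) (u ^ n)] with P h1 h2 h3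
    rw [aeval_monomial, aeval_monomial, h3, h1, h2]

lemma eventually_val_aevalAeval (u v : E.toAffine.FunctionField) (f : F[X][Y]) :
    ∀ᶠ P in cofinite, val (aevalAeval u v f) P = aevalAeval (val u P) (val v P) f := by
  induction f using Polynomial.induction_on' with
  | add f g hf hg =>
    filter_upwards [hf, hg, eventually_val_add (aevalAeval u v f) (aevalAeval u v g)]
      with P h1 h2 h3
    rw [map_add, map_add, h3, h1, h2]
  | monomial n c =>
    filter_upwards [eventually_val_aeval u c, eventually_val_pow v n,
      eventually_val_mul (aeval u c) (v ^ n)] with P h1 h2 h3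
    rw [← C_mul_X_pow_eq_monomial, map_mul, map_mul, map_pow, map_pow, aevalAeval_C, aevalAeval_C,
      aevalAeval_Y, aevalAeval_Y, h3, h1, h2]

variable (E) in
/-- The coordinate function `x`. -/
def xFF : E.toAffine.FunctionField := polyFF E (C X)

variable (E) in
/-- The coordinate function `y`. -/
def yFF : E.toAffine.FunctionField := polyFF E Y

lemma eventually_val_xFF : ∀ᶠ P in cofinite, val (xFF E) P = xc P := by
  filter_upwards [eventually_val_polyFF (E := E) (C X)] with P h
  rw [xFF, h, aevalAeval_X]

lemma eventually_val_yFF : ∀ᶠ P in cofinite, val (yFF E) P = yc P := by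
  filter_upwards [eventually_val_polyFF (E := E) Y] with P h
  rw [yFF, h, aevalAeval_Y]

lemma polyFF_eq_aevalAeval (f : F[X][Y]) : polyFF E f = aevalAeval (xFF E) (yFF E) f := by
  induction f using Polynomial.induction_on' with
  | add f g hf hg => rw [map_add, map_add, hf, hg]
  | monomial n c =>
    rw [← C_mul_X_pow_eq_monomial, map_mul, map_mul, map_pow, map_pow, aevalAeval_C, aevalAeval_Y]
    congr 1
    induction c using Polynomial.induction_on' with
    | add f g hf hg => rw [map_add, map_add, map_add, hf, hg]
    | monomial n c =>
      rw [← C_mul_X_pow_eq_monomial, map_mul, map_mul, map_mul, map_pow, map_pow, map_pow, aeval_C,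
        aeval_X, algebraMap_eq_polyFF]
      rfl

end Evaluation

/-! ### Isogenies as generic maps, their pullbacks, and multiplicativity of the degree. -/

section Generic

variable {F : Type*} [Field F] {E₁ E₂ E₃ : WeierstrassCurve F}

/-- At all but finitely many points, `α` is given by the values of `u` and `v`. -/
def IsGenericallyGivenBy (α : GeomPoint E₁ →+ GeomPoint E₂) (u v : E₁.toAffine.FunctionField) :
    Prop :=
  ∀ᶠ P in cofinite, ∃ h : (geomCurve E₂).Nonsingular (val u P) (val v P), α P = .some _ _ h

lemma IsGivenBy.generically {α : GeomPoint E₁ →+ GeomPoint E₂} {u v : E₁.toAffine.FunctionField}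
    (h : IsGivenBy α u v) : IsGenericallyGivenBy α u v := by
  obtain ⟨a, b, c, hb, hu, hv, hα⟩ := h
  have hb' := polyFF_ne_zero.2 hb
  have hua := eventually_val_div a hb'
  have hvc := eventually_val_div c hb'
  change u = polyFF E₁ a / polyFF E₁ b at hu
  change v = polyFF E₁ c / polyFF E₁ b at hv
  rw [← hu] at hua
  rw [← hv] at hvc
  filter_upwards [hua, hvc, eventually_pe_ne_zero hb, eventually_ne_zero] with P h1 h2 h3 h4
  rw [h1, h2]
  obtain ⟨h, hP⟩ := hα (xc P) (yc P) (nonsingular_of_ne_zero h4) h3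
  exact ⟨h, by rw [← hP, ← eq_some_of_ne_zero h4]⟩

/-- The finitely many exceptional points can be absorbed into the common denominator, where
`IsGivenBy` demands nothing. -/
lemma IsGenericallyGivenBy.isGivenBy {α : GeomPoint E₁ →+ GeomPoint E₂}
    {u v : E₁.toAffine.FunctionField} (h : IsGenericallyGivenBy α u v) : IsGivenBy α u v := by
  obtain ⟨a, b, hb, hu⟩ := exists_eq_polyFF_div u
  obtain ⟨c, d, hd, hv⟩ := exists_eq_polyFF_div v
  have hev : ∀ᶠ P : GeomPoint E₁ in cofinite, ∃ h : (geomCurve E₂).Nonsingular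
      (pe P a / pe P b) (pe P c / pe P d), α P = .some _ _ h := by
    have hua := eventually_val_div a hb
    have hvc := eventually_val_div c hd
    rw [← hu] at hua
    rw [← hv] at hvc
    filter_upwards [h, hua, hvc] with P h1 h2 h3
    rw [← h2, ← h3]
    exact h1
  have hfin := eventually_cofinite.1 hev
  -- Exceptional points need not be rational over `F`; minimal polynomials give a polynomial over
  -- `F` vanishing at all their `x`-coordinates.
  let G : F[X] := ∏ P ∈ hfin.toFinset, minpoly F (xc P)
  have hG0 : G ≠ 0 := Finset.prod_ne_zero_iff.2 fun P _ ↦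
    minpoly.ne_zero (Algebra.IsIntegral.isIntegral _)
  have hG : polyFF E₁ (C G) ≠ 0 := by
    rw [polyFF_ne_zero, ← map_zero (CoordinateRing.mk E₁.toAffine)]
    intro h0
    have := (CoordinateRing.smul_basis_eq_zero (W' := E₁.toAffine) (p := G) (q := 0) (by
      rw [zero_smul, add_zero, CoordinateRing.smul, mul_one, h0, map_zero])).1
    exact hG0 this
  refine ⟨a * d * C G, b * d * C G, c * b * C G, ?_, ?_, ?_, fun x y hxy hne ↦ ?_⟩
  · rw [← polyFF_ne_zero, map_mul, map_mul]
    exact mul_ne_zero (mul_ne_zero hb hd) hG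
  · change u = polyFF E₁ (a * d * C G) / polyFF E₁ (b * d * C G)
    rw [hu, map_mul, map_mul, map_mul, map_mul]
    field_simp
  · change v = polyFF E₁ (c * b * C G) / polyFF E₁ (b * d * C G)
    rw [hv, map_mul, map_mul, map_mul, map_mul]
    field_simp
  · simp only [map_mul] at hne
    obtain ⟨⟨hb1, hd1⟩, hG1⟩ : (aevalAeval x y b ≠ 0 ∧ aevalAeval x y d ≠ 0) ∧
      aevalAeval x y (C G) ≠ 0 := by simpa only [mul_ne_zero_iff] using hne
    have e1 : aevalAeval x y (a * d * C G) / aevalAeval x y (b * d * C G) =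
        aevalAeval x y a / aevalAeval x y b := by
      rw [map_mul, map_mul, map_mul, map_mul, mul_div_mul_right _ _ hG1,
        mul_div_mul_right _ _ hd1]
    have e2 : aevalAeval x y (c * b * C G) / aevalAeval x y (b * d * C G) =
        aevalAeval x y c / aevalAeval x y d := by
      rw [map_mul, map_mul, map_mul, map_mul, mul_div_mul_right _ _ hG1,
        mul_comm (aevalAeval x y b), mul_div_mul_right _ _ hb1]
    rw [e1, e2]
    by_contra hcon
    apply hG1
    rw [aevalAeval_C, map_prod]
    exact Finset.prod_eq_zero (i := .some x y hxy) (hfin.mem_toFinset.2 hcon) (minpoly.aeval F x)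

lemma isGivenBy_iff {α : GeomPoint E₁ →+ GeomPoint E₂} {u v : E₁.toAffine.FunctionField} :
    IsGivenBy α u v ↔ IsGenericallyGivenBy α u v :=
  ⟨IsGivenBy.generically, IsGenericallyGivenBy.isGivenBy⟩

namespace IsGenericallyGivenBy

variable {α : GeomPoint E₁ →+ GeomPoint E₂} {β : GeomPoint E₂ →+ GeomPoint E₃}
  {u v : E₁.toAffine.FunctionField}

lemma eventually_xc (h : IsGenericallyGivenBy α u v) :
    ∀ᶠ P in cofinite, val u P = xc (α P) := by
  filter_upwards [h] with P ⟨_, hP⟩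
  rw [hP, xc_some]

lemma eventually_yc (h : IsGenericallyGivenBy α u v) :
    ∀ᶠ P in cofinite, val v P = yc (α P) := by
  filter_upwards [h] with P ⟨_, hP⟩
  rw [hP, yc_some]

lemma eventually_apply_ne_zero (h : IsGenericallyGivenBy α u v) :
    ∀ᶠ P in cofinite, α P ≠ 0 := by
  filter_upwards [h] with P ⟨_, hP⟩
  rw [hP]
  exact Point.some_ne_zero _

lemma of_eventually (h : ∀ᶠ P in cofinite, α P ≠ 0) (hu : ∀ᶠ P in cofinite, val u P = xc (α P))
    (hv : ∀ᶠ P in cofinite, val v P = yc (α P)) : IsGenericallyGivenBy α u v := by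
  filter_upwards [h, hu, hv] with P h1 h2 h3
  rw [h2, h3]
  exact ⟨nonsingular_of_ne_zero h1, eq_some_of_ne_zero h1⟩

/-- Nonempty fibres are cosets of the kernel, which is finite. Statements about almost all points of
`E₂` can thus be pulled back along `α`. -/
lemma tendsto_cofinite (h : IsGenericallyGivenBy α u v) : Tendsto α cofinite cofinite := by
  refine Tendsto.cofinite_of_finite_preimage_singleton fun Q ↦ ?_
  have hker : {P | α P = 0}.Finite := by
    refine h.eventually_apply_ne_zero.subset fun P hP ↦ ?_
    simpa using hP
  by_cases hQ : ∃ P, α P = Q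
  · obtain ⟨P₀, hP₀⟩ := hQ
    refine (hker.image (P₀ + ·)).subset fun P hP ↦ ⟨P - P₀, ?_, by simp⟩
    have hP' : α P = Q := hP
    simp [hP', hP₀]
  · exact Set.finite_empty.subset fun P hP ↦ hQ ⟨P, hP⟩

variable [E₁.IsElliptic]

lemma unique (h : IsGenericallyGivenBy α u v) {u' v' : E₁.toAffine.FunctionField}
    (h' : IsGenericallyGivenBy α u' v') : u = u' ∧ v = v' := by
  constructor
  · apply eq_of_eventually_val_eq
    filter_upwards [h.eventually_xc, h'.eventually_xc] with P h1 h2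
    rw [h1, h2]
  · apply eq_of_eventually_val_eq
    filter_upwards [h.eventually_yc, h'.eventually_yc] with P h1 h2
    rw [h1, h2]

lemma ne_zero (h : IsGenericallyGivenBy α u v) : α ≠ 0 := by
  rintro rfl
  obtain ⟨P, hP⟩ := h.eventually_apply_ne_zero.exists
  exact hP rfl

/-- Transcendence of `u` over `F`: otherwise `x(α P)` would be a root of `f` for almost all `P`,
against the finiteness of the fibres. -/
lemma aeval_ne_zero (h : IsGenericallyGivenBy α u v) {f : F[X]} (hf : f ≠ 0) :
    aeval u f ≠ 0 := by
  intro h0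
  obtain ⟨P, h1, h2, h3, h4⟩ := ((h.tendsto_cofinite.eventually
    (eventually_aeval_xc_ne_zero hf)).and (h.eventually_xc.and ((eventually_val_aeval u f).and
      eventually_val_zero))).exists
  rw [h0, h4, h2] at h3
  exact h1 h3.symm

lemma pullbackField_eq (h : IsGenericallyGivenBy α u v) :
    pullbackField α = IntermediateField.adjoin F {u, v} := by
  rw [pullbackField]
  congr 1
  ext w
  constructor
  · rintro ⟨u', v', h', hw⟩
    obtain ⟨rfl, rfl⟩ := h.unique h'.generically
    exact hw
  · exact fun hw ↦ ⟨u, v, h.isGivenBy, hw⟩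

/-- Substitute `u, v` for the coordinates in a fraction for `w`; finite fibres keep the denominator
from becoming zero. -/
lemma exists_val_comp (h : IsGenericallyGivenBy α u v) (w : E₂.toAffine.FunctionField) :
    ∃ w' : E₁.toAffine.FunctionField, ∀ᶠ P in cofinite, val w' P = val w (α P) := by
  obtain ⟨a, b, hb, hw⟩ := exists_eq_polyFF_div w
  have key (f : F[X][Y]) : ∀ᶠ P in cofinite, val (aevalAeval u v f) P = pe (α P) f := by
    filter_upwards [eventually_val_aevalAeval u v f, h.eventually_xc, h.eventually_yc]
      with P h1 h2 h3
    rw [h1, h2, h3]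
  have hb' : aevalAeval u v b ≠ 0 := by
    intro h0
    obtain ⟨P, h1, h2, h3⟩ := ((h.tendsto_cofinite.eventually (eventually_pe_ne_zero' hb)).and
      ((key b).and eventually_val_zero)).exists
    rw [h0, h3] at h2
    exact h1 h2.symm
  have hw' := h.tendsto_cofinite.eventually (eventually_val_div a hb)
  rw [← hw] at hw'
  refine ⟨aevalAeval u v a / aevalAeval u v b, ?_⟩
  filter_upwards [eventually_val_div' (aevalAeval u v a) _ hb', key a, key b, hw']
    with P h1 h2 h3 h4
  rw [h1, h2, h3, h4]

/-- The pullback of rational functions along a homomorphism given by rational functions. -/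
def comorphism (h : IsGenericallyGivenBy α u v) :
    E₂.toAffine.FunctionField →ₐ[F] E₁.toAffine.FunctionField :=
  have spec w := (h.exists_val_comp w).choose_spec
  { toFun w := (h.exists_val_comp w).choose
    map_one' := eq_of_eventually_val_eq <| by
      filter_upwards [spec 1, eventually_val_one,
        h.tendsto_cofinite.eventually eventually_val_one] with P h1 h2 h3
      rw [h1, h2, h3]
    map_zero' := eq_of_eventually_val_eq <| by
      filter_upwards [spec 0, eventually_val_zero,
        h.tendsto_cofinite.eventually eventually_val_zero] with P h1 h2 h3
      rw [h1, h2, h3]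
    map_mul' w z := eq_of_eventually_val_eq <| by
      filter_upwards [spec (w * z), spec w, spec z, eventually_val_mul
        (h.exists_val_comp w).choose (h.exists_val_comp z).choose,
        h.tendsto_cofinite.eventually (eventually_val_mul w z)] with P h1 h2 h3 h4 h5
      rw [h1, h4, h2, h3, h5]
    map_add' w z := eq_of_eventually_val_eq <| by
      filter_upwards [spec (w + z), spec w, spec z, eventually_val_add
        (h.exists_val_comp w).choose (h.exists_val_comp z).choose,
        h.tendsto_cofinite.eventually (eventually_val_add w z)] with P h1 h2 h3 h4 h5
      rw [h1, h4, h2, h3, h5]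
    commutes' c := eq_of_eventually_val_eq <| by
      filter_upwards [spec (algebraMap F _ c), eventually_val_algebraMap c,
        h.tendsto_cofinite.eventually (eventually_val_algebraMap c)] with P h1 h2 h3
      rw [h1, h2, h3] }

lemma eventually_val_comorphism (h : IsGenericallyGivenBy α u v)
    (w : E₂.toAffine.FunctionField) :
    ∀ᶠ P in cofinite, val (h.comorphism w) P = val w (α P) :=
  (h.exists_val_comp w).choose_spec

lemma comorphism_xFF (h : IsGenericallyGivenBy α u v) : h.comorphism (xFF E₂) = u := by
  apply eq_of_eventually_val_eq
  filter_upwards [h.eventually_val_comorphism (xFF E₂), h.eventually_xc,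
    h.tendsto_cofinite.eventually eventually_val_xFF] with P h1 h2 h3
  rw [h1, h2, h3]

lemma comorphism_yFF (h : IsGenericallyGivenBy α u v) : h.comorphism (yFF E₂) = v := by
  apply eq_of_eventually_val_eq
  filter_upwards [h.eventually_val_comorphism (yFF E₂), h.eventually_yc,
    h.tendsto_cofinite.eventually eventually_val_yFF] with P h1 h2 h3
  rw [h1, h2, h3]

end IsGenericallyGivenBy

variable (E₁) in
lemma adjoin_xFF_yFF :
    IntermediateField.adjoin F {xFF E₁, yFF E₁} = ⊤ := by
  rw [eq_top_iff]
  rintro w -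
  obtain ⟨a, b, hb, rfl⟩ := exists_eq_polyFF_div w
  have key (f : F[X][Y]) : polyFF E₁ f ∈ IntermediateField.adjoin F {xFF E₁, yFF E₁} := by
    have hx : xFF E₁ ∈ IntermediateField.adjoin F {xFF E₁, yFF E₁} :=
      IntermediateField.subset_adjoin _ _ (by simp)
    have hy : yFF E₁ ∈ IntermediateField.adjoin F {xFF E₁, yFF E₁} :=
      IntermediateField.subset_adjoin _ _ (by simp)
    rw [polyFF_eq_aevalAeval]
    induction f using Polynomial.induction_on' with
    | add f g hf hg => rw [map_add]; exact add_mem hf hg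
    | monomial n c =>
      rw [← C_mul_X_pow_eq_monomial, map_mul, map_pow, aevalAeval_C, aevalAeval_Y]
      refine mul_mem ?_ (pow_mem hy n)
      have := aeval_algHom_apply (IntermediateField.adjoin F {xFF E₁, yFF E₁}).val ⟨_, hx⟩ c
      rw [IntermediateField.coe_val] at this
      rw [this]
      exact Subtype.property _
  exact div_mem (key a) (key b)

lemma isIsogeny_iff {α : GeomPoint E₁ →+ GeomPoint E₂} :
    IsIsogeny α ↔ ∃ u v, IsGenericallyGivenBy α u v := by
  simp only [IsIsogeny, isGivenBy_iff]

lemma IsGenericallyGivenBy.pullbackField_eq_map [E₁.IsElliptic] {α : GeomPoint E₁ →+ GeomPoint E₂}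
    {u v : E₁.toAffine.FunctionField} (h : IsGenericallyGivenBy α u v) :
    pullbackField α = (⊤ : IntermediateField F E₂.toAffine.FunctionField).map h.comorphism := by
  rw [h.pullbackField_eq, ← adjoin_xFF_yFF, IntermediateField.adjoin_map, Set.image_pair,
    h.comorphism_xFF, h.comorphism_yFF]

lemma IsGenericallyGivenBy.comp [E₁.IsElliptic] [E₂.IsElliptic]
    {α : GeomPoint E₁ →+ GeomPoint E₂} {β : GeomPoint E₂ →+ GeomPoint E₃}
    {u v : E₁.toAffine.FunctionField} {u' v' : E₂.toAffine.FunctionField}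
    (hα : IsGenericallyGivenBy α u v) (hβ : IsGenericallyGivenBy β u' v') :
    IsGenericallyGivenBy (β.comp α) (hα.comorphism u') (hα.comorphism v') := by
  refine .of_eventually (hα.tendsto_cofinite.eventually hβ.eventually_apply_ne_zero) ?_ ?_
  · filter_upwards [hα.eventually_val_comorphism u',
      hα.tendsto_cofinite.eventually hβ.eventually_xc] with P h1 h2
    rw [h1, h2, AddMonoidHom.comp_apply]
  · filter_upwards [hα.eventually_val_comorphism v',
      hα.tendsto_cofinite.eventually hβ.eventually_yc] with P h1 h2
    rw [h1, h2, AddMonoidHom.comp_apply]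

lemma IsIsogeny.comp [E₁.IsElliptic] [E₂.IsElliptic]
    {α : GeomPoint E₁ →+ GeomPoint E₂} {β : GeomPoint E₂ →+ GeomPoint E₃}
    (hβ : IsIsogeny β) (hα : IsIsogeny α) : IsIsogeny (β.comp α) := by
  obtain ⟨u, v, hα⟩ := isIsogeny_iff.1 hα
  obtain ⟨u', v', hβ⟩ := isIsogeny_iff.1 hβ
  exact isIsogeny_iff.2 ⟨_, _, hα.comp hβ⟩

/-- Tower law: the comorphism of `α` carries the extension defining `degree β` onto the step between
the pullback fields of `β ∘ α` and `α`. -/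
lemma degree_comp [E₁.IsElliptic] [E₂.IsElliptic]
    {α : GeomPoint E₁ →+ GeomPoint E₂} {β : GeomPoint E₂ →+ GeomPoint E₃}
    (hβ : IsIsogeny β) (hα : IsIsogeny α) : degree (β.comp α) = degree β * degree α := by
  obtain ⟨u, v, hα⟩ := isIsogeny_iff.1 hα
  obtain ⟨u', v', hβ⟩ := isIsogeny_iff.1 hβ
  have h1 : pullbackField (β.comp α) = (pullbackField β).map hα.comorphism := by
    rw [(hα.comp hβ).pullbackField_eq, hβ.pullbackField_eq, IntermediateField.adjoin_map,
      Set.image_pair]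
  have h2 := hα.pullbackField_eq_map
  rw [degree, degree, degree, ← IntermediateField.relfinrank_top_right,
    ← IntermediateField.relfinrank_top_right, ← IntermediateField.relfinrank_top_right, h1,
    ← IntermediateField.relfinrank_map_map (f := hα.comorphism) (A := pullbackField β), ← h2]
  refine (IntermediateField.relfinrank_mul_relfinrank ?_ le_top).symm
  rw [h2]
  exact IntermediateField.map_mono _ le_top

lemma isGenericallyGivenBy_id :
    IsGenericallyGivenBy (AddMonoidHom.id (GeomPoint E₁)) (xFF E₁) (yFF E₁) :=
  .of_eventually eventually_ne_zero eventually_val_xFF eventually_val_yFF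

/-- No pair of functions gives the zero map, so its pullback field is `F`, over which `x` is
transcendental; `finrank` of an infinite extension is `0`. -/
lemma degree_zero [E₁.IsElliptic] : degree (0 : GeomPoint E₁ →+ GeomPoint E₂) = 0 := by
  have h : pullbackField (0 : GeomPoint E₁ →+ GeomPoint E₂) = ⊥ := by
    rw [pullbackField, ← IntermediateField.adjoin_empty]
    congr 1
    ext w
    simp only [Set.mem_ofPred_eq, Set.mem_empty_iff_false, iff_false]
    rintro ⟨u, v, h, -⟩
    exact h.generically.ne_zero rfl
  rw [degree, h, IntermediateField.finrank_bot', Module.finrank_of_not_finite]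
  intro hfin
  exact isGenericallyGivenBy_id.aeval_ne_zero (minpoly.ne_zero
    (Algebra.IsIntegral.isIntegral (R := F) (xFF E₁))) (minpoly.aeval F (xFF E₁))

lemma degree_id [E₁.IsElliptic] : degree (AddMonoidHom.id (GeomPoint E₁)) = 1 := by
  rw [degree, isGenericallyGivenBy_id.pullbackField_eq, adjoin_xFF_yFF]
  exact IntermediateField.finrank_top

end Generic

/-! ### Functions of `x` alone, and the degree of an isogeny read from its `x`-coordinate. -/

section RationalInX

variable {F : Type*} [Field F]

section

variable {E : WeierstrassCurve F}

lemma aeval_xFF (f : F[X]) : aeval (xFF E) f = polyFF E (C f) := by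
  rw [polyFF_eq_aevalAeval, aevalAeval_C]

lemma xc_neg (P : GeomPoint E) : xc (-P) = xc P := by
  cases P <;> rfl

lemma yc_neg {P : GeomPoint E} (hP : P ≠ 0) :
    yc (-P) = -yc P - algebraMap F _ E.a₁ * xc P - algebraMap F _ E.a₃ := by
  cases P with
  | zero => exact absurd rfl hP
  | some x y h => rfl

lemma tendsto_neg_cofinite : Tendsto (fun P : GeomPoint E ↦ -P) cofinite cofinite :=
  neg_injective.tendsto_cofinite

/-- Equality means that `2y + a₁x + a₃` vanishes, and this function is nonzero because its
coefficient at `y` is `2`. -/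
lemma eventually_yc_neg_ne (h2 : (2 : F) ≠ 0) :
    ∀ᶠ P : GeomPoint E in cofinite, yc (-P) ≠ yc P := by
  have hne : CoordinateRing.mk E.toAffine (C (C E.a₁ * X + C E.a₃) + C (C 2) * Y) ≠ 0 := by
    intro h0
    have h := (CoordinateRing.smul_basis_eq_zero (W' := E.toAffine) (p := C E.a₁ * X + C E.a₃)
      (q := C 2) (by
        rw [CoordinateRing.smul, CoordinateRing.smul, mul_one, ← map_mul, ← map_add, h0])).2
    exact h2 (C_eq_zero.1 h)
  filter_upwards [eventually_pe_ne_zero hne, eventually_ne_zero] with P hP hP0 h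
  apply hP
  rw [yc_neg hP0] at h
  simp only [map_add, map_mul, aevalAeval_Y, aevalAeval_C, aeval_X, aeval_C]
  rw [map_ofNat]
  linear_combination -h

lemma eventually_val_aeval_xFF (f : F[X]) :
    ∀ᶠ P in cofinite, val (aeval (xFF E) f) P = aeval (xc P) f := by
  filter_upwards [eventually_val_aeval (xFF E) f, eventually_val_xFF] with P h1 h2
  rw [h1, h2]

variable [E.IsElliptic]

lemma aeval_xFF_injective : Function.Injective (aeval (R := F) (xFF E)) := by
  rw [injective_iff_map_eq_zero]
  intro f hf
  by_contra h0
  exact isGenericallyGivenBy_id.aeval_ne_zero h0 hf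

variable (E) in
/-- The embedding `F(X) → F(E)` which maps `X` to the coordinate function `x`. -/
def ratFF : RatFunc F →ₐ[F] E.toAffine.FunctionField :=
  RatFunc.liftAlgHom (aeval (xFF E))
    (nonZeroDivisors_le_comap_nonZeroDivisors_of_injective _ aeval_xFF_injective)

lemma ratFF_apply (r : RatFunc F) :
    ratFF E r = aeval (xFF E) r.num / aeval (xFF E) r.denom := by
  rw [ratFF, RatFunc.liftAlgHom_apply]

lemma ratFF_algebraMap (f : F[X]) : ratFF E (algebraMap F[X] (RatFunc F) f) = aeval (xFF E) f := by
  rw [ratFF_apply, RatFunc.num_algebraMap, RatFunc.denom_algebraMap, map_one, div_one]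

lemma aeval_xFF_denom_ne_zero (r : RatFunc F) : aeval (xFF E) r.denom ≠ 0 :=
  isGenericallyGivenBy_id.aeval_ne_zero r.denom_ne_zero

lemma eventually_val_ratFF (r : RatFunc F) : ∀ᶠ P in cofinite,
    val (ratFF E r) P = aeval (xc P) r.num / aeval (xc P) r.denom := by
  rw [ratFF_apply]
  filter_upwards [eventually_val_div' (aeval (xFF E) r.num) _ (aeval_xFF_denom_ne_zero r),
    eventually_val_aeval_xFF r.num, eventually_val_aeval_xFF r.denom] with P h1 h2 h3
  rw [h1, h2, h3]

lemma eventually_val_ratFF_neg (r : RatFunc F) : ∀ᶠ P in cofinite,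
    val (ratFF E r) (-P) = val (ratFF E r) P := by
  filter_upwards [eventually_val_ratFF r, tendsto_neg_cofinite.eventually
    (eventually_val_ratFF (E := E) r)] with P h1 h2
  rw [h1, h2, xc_neg]

/-- Rationalise the denominator: multiplying `b` by its conjugate `b'` gives its norm, a polynomial
in `x`. -/
lemma exists_eq_ratFF_add (w : E.toAffine.FunctionField) :
    ∃ r s : RatFunc F, w = ratFF E r + ratFF E s * yFF E := by
  obtain ⟨a, b, hb, rfl⟩ := exists_eq_polyFF_div w
  obtain ⟨p, q, hpq⟩ := CoordinateRing.exists_smul_basis_eq (CoordinateRing.mk E.toAffine b)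
  set n := Algebra.norm F[X] (p • (1 : E.toAffine.CoordinateRing) +
      q • CoordinateRing.mk E.toAffine Y) with hn
  have h1 := CoordinateRing.coe_norm_smul_basis (W' := E.toAffine) p q
  rw [← hn] at h1
  set b' : F[X][Y] := C p + C q * (-(Y : F[X][Y]) - C (C E.a₁ * X + C E.a₃))
  have hbb : polyFF E b * polyFF E b' = aeval (xFF E) n := by
    rw [aeval_xFF, polyFF, RingHom.comp_apply, RingHom.comp_apply, RingHom.comp_apply, ← map_mul,
      ← hpq]
    refine congrArg _ (Eq.trans ?_ h1.symm)
    rw [map_mul, CoordinateRing.smul, CoordinateRing.smul, mul_one, ← map_mul, ← map_add]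
  have hn0 : aeval (xFF E) n ≠ 0 := by
    apply isGenericallyGivenBy_id.aeval_ne_zero
    rw [hn, hpq, ne_eq, Algebra.norm_eq_zero_iff_of_basis (CoordinateRing.basis E.toAffine)]
    exact polyFF_ne_zero.1 hb
  have hb' : polyFF E b' ≠ 0 := right_ne_zero_of_mul (hbb ▸ hn0)
  obtain ⟨c, d, hcd⟩ := CoordinateRing.exists_smul_basis_eq (CoordinateRing.mk E.toAffine (a * b'))
  have hab : polyFF E (a * b') = aeval (xFF E) c + aeval (xFF E) d * yFF E := by
    rw [aeval_xFF, aeval_xFF, yFF, ← map_mul, ← map_add, polyFF, RingHom.comp_apply,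
      RingHom.comp_apply, ← hcd, CoordinateRing.smul, CoordinateRing.smul, mul_one, ← map_mul,
      ← map_add]
  refine ⟨algebraMap _ _ c / algebraMap _ _ n, algebraMap _ _ d / algebraMap _ _ n, ?_⟩
  rw [map_div₀, map_div₀, ratFF_algebraMap, ratFF_algebraMap, ratFF_algebraMap,
    ← mul_div_mul_right _ _ hb', hbb, ← map_mul, hab]
  ring

/-- In `w = r + s y`, comparing values at `P` and `-P` forces `s = 0`, since only `y` changes. -/
lemma exists_eq_ratFF (h2 : (2 : F) ≠ 0) {w : E.toAffine.FunctionField}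
    (hw : ∀ᶠ P in cofinite, val w (-P) = val w P) : ∃ r, w = ratFF E r := by
  obtain ⟨r, s, rfl⟩ := exists_eq_ratFF_add w
  by_cases hs : ratFF E s = 0
  · exact ⟨r, by rw [hs, zero_mul, add_zero]⟩
  exfalso
  have hadd := eventually_val_add (ratFF E r) (ratFF E s * yFF E)
  have hmul := eventually_val_mul (ratFF E s) (yFF E)
  obtain ⟨P, h1, h2, h3, h4, h5, h6, h7, h8, h9, h10, h11⟩ := (hw.and <|
    hadd.and <| (tendsto_neg_cofinite.eventually hadd).and <|
    hmul.and <| (tendsto_neg_cofinite.eventually hmul).and <|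
    (eventually_val_ratFF_neg r).and <| (eventually_val_ratFF_neg s).and <|
    (eventually_val_yFF).and <| (tendsto_neg_cofinite.eventually eventually_val_yFF).and <|
    (eventually_val_ne_zero hs).and (eventually_yc_neg_ne h2)).exists
  rw [h2, h3, h4, h5, h6, h7, h8, h9, add_right_inj] at h1
  exact h11 (mul_left_cancel₀ h10 h1)

lemma finrank_map_ratFF (h2 : (2 : F) ≠ 0) :
    Module.finrank ((⊤ : IntermediateField F (RatFunc F)).map (ratFF E))
      E.toAffine.FunctionField = 2 := by
  set R := (⊤ : IntermediateField F (RatFunc F)).map (ratFF E)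
  have hR (w : R) : ∃ r, (w : E.toAffine.FunctionField) = ratFF E r := by
    obtain ⟨r, -, hr⟩ := w.2
    exact ⟨r, hr.symm⟩
  have hmem (r : RatFunc F) : ratFF E r ∈ R := ⟨r, trivial, rfl⟩
  have hli : LinearIndependent R ![(1 : E.toAffine.FunctionField), yFF E] := by
    rw [LinearIndependent.pair_iff]
    intro s t hst
    obtain ⟨s', hs'⟩ := hR s
    obtain ⟨t', ht'⟩ := hR t
    rw [IntermediateField.smul_def, IntermediateField.smul_def, smul_eq_mul, smul_eq_mul, mul_one,
      hs', ht'] at hst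
    have ht : t = 0 := by
      by_contra ht0
      have ht1 : ratFF E t' ≠ 0 := by rwa [← ht', ne_eq, ZeroMemClass.coe_eq_zero]
      have hy : yFF E = ratFF E (-s' / t') := by
        rw [map_div₀, map_neg, eq_div_iff ht1]
        linear_combination hst
      obtain ⟨P, h1, h2, h3, h4⟩ := ((eventually_val_ratFF_neg (E := E) (-s' / t')).and <|
        eventually_val_yFF.and <| (tendsto_neg_cofinite.eventually eventually_val_yFF).and
          (eventually_yc_neg_ne h2)).exists
      rw [← hy, h2, h3] at h1
      exact h4 h1
    refine ⟨?_, ht⟩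
    rw [← ht', ht, ZeroMemClass.coe_zero, zero_mul, add_zero, ← hs', ZeroMemClass.coe_eq_zero]
      at hst
    exact hst
  have hspan : ⊤ ≤ Submodule.span R (Set.range ![(1 : E.toAffine.FunctionField), yFF E]) := by
    rintro w -
    obtain ⟨r, s, rfl⟩ := exists_eq_ratFF_add w
    refine add_mem ?_ ?_
    · have : ratFF E r = (⟨_, hmem r⟩ : R) • (1 : E.toAffine.FunctionField) := by
        rw [IntermediateField.smul_def, smul_eq_mul, mul_one]
      rw [this]
      exact Submodule.smul_mem _ _ (Submodule.subset_span ⟨0, rfl⟩)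
    · exact Submodule.smul_mem _ (⟨_, hmem s⟩ : R) (Submodule.subset_span ⟨1, rfl⟩)
  rw [Module.finrank_eq_card_basis (Module.Basis.mk hli hspan), Fintype.card_fin]

lemma map_ratFF_top : (⊤ : IntermediateField F (RatFunc F)).map (ratFF E) =
    IntermediateField.adjoin F {xFF E} := by
  rw [← RatFunc.adjoin_X, IntermediateField.adjoin_map, Set.image_singleton, ← RatFunc.algebraMap_X,
    ratFF_algebraMap, aeval_X]

end

variable {E₁ E₂ : WeierstrassCurve F} [E₁.IsElliptic]
  {α : GeomPoint E₁ →+ GeomPoint E₂} {u v : E₁.toAffine.FunctionField}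

lemma IsGenericallyGivenBy.exists_eq_ratFF (h2 : (2 : F) ≠ 0) (h : IsGenericallyGivenBy α u v) :
    ∃ r, u = ratFF E₁ r := by
  apply EllipticIsogeny.exists_eq_ratFF h2
  filter_upwards [h.eventually_xc, tendsto_neg_cofinite.eventually h.eventually_xc] with P h1 h2
  rw [h1, h2, map_neg, xc_neg]

variable [E₂.IsElliptic]

/-- Compute `[F(E₁) : F(u)]` in two ways: through `α^* F(E₂)` it is `2 · degree α`, and through
`F(x)` it is twice the degree of `r`. -/
lemma IsGenericallyGivenBy.degree_eq (h2 : (2 : F) ≠ 0) {r : RatFunc F}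
    (h : IsGenericallyGivenBy α (ratFF E₁ r) v) :
    degree α = max r.num.natDegree r.denom.natDegree := by
  rw [← RatFunc.finrank_eq_max_natDegree]
  set A := IntermediateField.adjoin F {ratFF E₁ r}
  have hA1 : A = (IntermediateField.adjoin F {r}).map (ratFF E₁) := by
    rw [IntermediateField.adjoin_map, Set.image_singleton]
  have hA2 : A = ((⊤ : IntermediateField F (RatFunc F)).map (ratFF E₂)).map h.comorphism := by
    rw [map_ratFF_top, IntermediateField.adjoin_map, Set.image_singleton, h.comorphism_xFF]
  have e1 : Module.finrank A E₁.toAffine.FunctionField = 2 * degree α := by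
    rw [← IntermediateField.relfinrank_mul_finrank_top
      (A := A) (B := pullbackField α), ← degree, h.pullbackField_eq_map, hA2,
      IntermediateField.relfinrank_map_map, IntermediateField.relfinrank_top_right,
      finrank_map_ratFF h2]
    rw [hA2, h.pullbackField_eq_map]
    exact IntermediateField.map_mono _ le_top
  have e2 : Module.finrank A E₁.toAffine.FunctionField =
      Module.finrank (IntermediateField.adjoin F {r}) (RatFunc F) * 2 := by
    rw [← IntermediateField.relfinrank_mul_finrank_top
      (A := A) (B := (⊤ : IntermediateField F (RatFunc F)).map (ratFF E₁)), finrank_map_ratFF h2,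
      hA1, IntermediateField.relfinrank_map_map, IntermediateField.relfinrank_top_right]
    rw [hA1]
    exact IntermediateField.map_mono _ le_top
  omega

end RationalInX

/-! ### The quadratic map taking `{x(P), x(Q)}` to `{x(P + Q), x(P - Q)}`. -/

section AddSub

lemma addSubMap_eval {R : Type*} [CommRing R] (W : WeierstrassCurve R) (s t u : R) (i : Fin 3) :
    (addSubMap W i).eval ![s, t, u] =
      ![s ^ 2 - W.b₄ * s * u - W.b₆ * t * u - W.b₈ * u ^ 2,
        2 * t * s + W.b₂ * s * u + W.b₄ * t * u + W.b₆ * u ^ 2, t ^ 2 - 4 * s * u] i := by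
  fin_cases i <;> simp [addSubMap]

variable {k : Type*} [Field k] [DecidableEq k] {W : WeierstrassCurve.Affine k}

lemma addSubMap_sym2x_self [W.IsElliptic] {x y : k} (h : W.Nonsingular x y) :
    ∃ c : k, c ≠ 0 ∧ ∀ i, (addSubMap W i).eval (Point.sym2x (.some x y h) (.some x y h)) =
      c * Point.sym2x (.some x y h + .some x y h) 0 i := by
  have he := (equation_iff' x y).1 h.1
  by_cases hy : y = W.negY x y
  · rw [Point.add_self_of_Y_eq hy, Point.sym2x_zero_zero, Point.sym2x_some_some]
    -- Here `2P = 0`, so the last two coordinates must vanish; the first then serves as the scalar,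
    -- being nonzero because the forms have no common zero.
    have hne := addSubMap_ne_zero W (x := ![x * x, x + x, 1]) fun h0 ↦
      one_ne_zero (congrFun h0 2)
    simp only [negY] at hy
    have h1 : (addSubMap W 1).eval ![x * x, x + x, 1] = 0 := by
      rw [addSubMap_eval]
      simp only [Matrix.cons_val_one, Matrix.cons_val_zero, b₂, b₄, b₆]
      linear_combination (2 * y + W.a₁ * x + W.a₃) * hy - 4 * he
    have h2 : (addSubMap W 2).eval ![x * x, x + x, 1] = 0 := by
      rw [addSubMap_eval]
      simp only [Matrix.cons_val]
      ring
    refine ⟨(addSubMap W 0).eval ![x * x, x + x, 1], fun h0 ↦ hne ?_, fun i ↦ ?_⟩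
    · ext i
      fin_cases i
      exacts [h0, h1, h2]
    · fin_cases i
      · simp
      · simpa using h1
      · simpa using h2
  · rw [Point.add_self_of_Y_ne hy, Point.sym2x_some_zero, Point.sym2x_some_some,
      slope_of_Y_ne rfl hy]
    have hη := sub_ne_zero.2 hy
    -- The scalar is the square of the denominator of the tangent slope.
    refine ⟨(y - W.negY x y) ^ 2, pow_ne_zero 2 hη, fun i ↦ ?_⟩
    rw [addSubMap_eval]
    fin_cases i
    · simp only [Fin.zero_eta, Matrix.cons_val_zero, addX]
      field_simp
      simp only [negY, b₄, b₆, b₈]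
      linear_combination (W.a₁ ^ 2 + 4 * (W.a₂ + 2 * x)) * he
    · simp only [Fin.mk_one, Matrix.cons_val_one, Matrix.cons_val_zero, negY, b₂, b₄, b₆]
      linear_combination -4 * he
    · simp only [Fin.reduceFinMk, Matrix.cons_val]
      ring

lemma addSubMap_sym2x_of_X_ne {x₁ y₁ x₂ y₂ : k} (h₁ : W.Nonsingular x₁ y₁)
    (h₂ : W.Nonsingular x₂ y₂) (hx : x₁ ≠ x₂) :
    ∃ c : k, c ≠ 0 ∧ ∀ i, (addSubMap W i).eval (Point.sym2x (.some x₁ y₁ h₁) (.some x₂ y₂ h₂)) =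
      c * Point.sym2x (.some x₁ y₁ h₁ + .some x₂ y₂ h₂) (.some x₁ y₁ h₁ - .some x₂ y₂ h₂) i := by
  have e₁ := (equation_iff' x₁ y₁).1 h₁.1
  have e₂ := (equation_iff' x₂ y₂).1 h₂.1
  have hD := sub_ne_zero.2 hx
  rw [sub_eq_add_neg, Point.neg_some, Point.add_of_X_ne hx, Point.add_of_X_ne hx,
    Point.sym2x_some_some, Point.sym2x_some_some, slope_of_X_ne hx, slope_of_X_ne hx]
  refine ⟨(x₁ - x₂) ^ 2, pow_ne_zero 2 hD, fun i ↦ ?_⟩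
  rw [addSubMap_eval]
  fin_cases i
  · simp only [Fin.zero_eta, Matrix.cons_val_zero, addX]
    field_simp
    simp only [negY, b₄, b₆, b₈]
    -- The difference quotient of the cubic in `x`, which enters on subtracting the two curve
    -- equations.
    set g := x₁ ^ 2 + x₁ * x₂ + x₂ ^ 2 + W.a₂ * (x₁ + x₂) + W.a₄
    linear_combination
      -((y₁ - y₂) * (y₁ + y₂ + W.a₁ * x₂ + W.a₃) + (x₁ - x₂) * (g - W.a₁ * y₁) +
        W.a₁ * (x₁ - x₂) * (2 * y₁ + W.a₁ * x₂ + W.a₃) + W.a₁ ^ 2 * (x₁ - x₂) ^ 2 +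
        2 * (W.a₂ + x₁ + x₂) * (x₁ - x₂) ^ 2) * (e₁ - e₂) +
      (x₁ - x₂) ^ 2 * (W.a₁ ^ 2 + 4 * (W.a₂ + x₁ + x₂)) * e₁
  · simp only [Fin.mk_one, Matrix.cons_val_one, Matrix.cons_val_zero, addX]
    field_simp
    simp only [negY, b₂, b₄, b₆]
    linear_combination 2 * (e₁ - e₂) - 4 * e₁
  · simp only [Fin.reduceFinMk, Matrix.cons_val]
    ring

/-- The map `addSubMap` describes `(x(P), x(Q)) ↦ (x(P + Q), x(P - Q))`. -/
theorem addSubMap_sym2x [W.IsElliptic] (P Q : W.Point) :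
    ∃ c : k, c ≠ 0 ∧ ∀ i, (addSubMap W i).eval (P.sym2x Q) = c * (P + Q).sym2x (P - Q) i := by
  have hzero (P : W.Point) : ∃ c : k, c ≠ 0 ∧ ∀ i, (addSubMap W i).eval (P.sym2x 0) =
      c * P.sym2x P i := by
    refine ⟨1, one_ne_zero, fun i ↦ ?_⟩
    cases P with
    | zero =>
      rw [← Point.zero_def, Point.sym2x_zero_zero, addSubMap_eval]
      fin_cases i <;> simp
    | some x y h =>
      rw [Point.sym2x_some_zero, addSubMap_eval, Point.sym2x_some_some]
      fin_cases i <;> simp <;> ring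
  by_cases hQ : Q = 0
  · subst hQ
    rw [add_zero, sub_zero]
    exact hzero P
  by_cases hP : P = 0
  · subst hP
    rw [zero_add, zero_sub, Point.sym2x_neg_right, Point.sym2x_comm]
    exact hzero Q
  have hself : ∃ c : k, c ≠ 0 ∧ ∀ i, (addSubMap W i).eval (Q.sym2x Q) = c * (Q + Q).sym2x 0 i := by
    cases Q with
    | zero => exact absurd rfl hQ
    | some x y h => exact addSubMap_sym2x_self h
  by_cases h1 : P = Q
  · subst h1
    rwa [sub_self]
  by_cases h2 : P = -Q
  · subst h2
    rwa [neg_add_cancel, ← neg_add', Point.sym2x_neg_left, Point.sym2x_neg_right,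
      Point.sym2x_comm 0]
  cases P with
  | zero => exact absurd rfl hP
  | some x₁ y₁ h₁ =>
    cases Q with
    | zero => exact absurd rfl hQ
    | some x₂ y₂ h₂ =>
      refine addSubMap_sym2x_of_X_ne h₁ h₂ fun hx ↦ ?_
      rcases Point.X_eq_iff.1 hx with h | h
      exacts [h1 h, h2 h]

end AddSub

/-! ### Degrees of polynomial vectors without common zero. -/

section TopDegree

variable {F : Type*} [Field F] {ι : Type*}

/-- The largest degree of the polynomials `S i` is `n`, and they do not all vanish. -/
def IsTopDegree (S : ι → F[X]) (n : ℕ) : Prop :=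
  (∀ i, (S i).natDegree ≤ n) ∧ ∃ i, (S i).coeff n ≠ 0

/-- Proportional vectors whose entries generate the unit ideal differ by a unit of `F[X]`, that is,
by a constant. The degree is therefore that of the projective map they define. -/
lemma IsTopDegree.le [Fintype ι] {S T : ι → F[X]} {n m : ℕ} (hS : IsTopDegree S n)
    (hT : IsTopDegree T m) (hS1 : Ideal.span (Set.range S) = ⊤)
    (hT1 : Ideal.span (Set.range T) = ⊤) (hST : ∀ i j, S i * T j = S j * T i) : n ≤ m := by
  obtain ⟨g, hg⟩ := Ideal.mem_span_range_iff_exists_fun.1 (hT1 ▸ Submodule.mem_top (x := 1))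
  -- The proportionality factor, obtained by applying the Bézout relation of `T` to `S`.
  set e := ∑ j, g j * S j
  have he (i : ι) : S i = T i * e := by
    calc S i = S i * ∑ j, g j * T j := by rw [hg, mul_one]
      _ = T i * e := by
        rw [Finset.mul_sum, Finset.mul_sum]
        exact Finset.sum_congr rfl fun j _ ↦ by linear_combination g j * hST i j
  have hunit : IsUnit e := by
    rw [← Ideal.span_singleton_eq_top, eq_top_iff, ← hS1, Ideal.span_le]
    rintro _ ⟨i, rfl⟩
    exact Ideal.mem_span_singleton.2 ⟨T i, by rw [he, mul_comm]⟩
  obtain ⟨i, hi⟩ := hS.2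
  calc n ≤ (S i).natDegree := le_natDegree_of_ne_zero hi
    _ ≤ (T i).natDegree + e.natDegree := he i ▸ natDegree_mul_le
    _ ≤ m := by rw [natDegree_eq_zero_of_isUnit hunit]; exact hT.1 i

lemma IsTopDegree.unique [Fintype ι] {S T : ι → F[X]} {n m : ℕ} (hS : IsTopDegree S n)
    (hT : IsTopDegree T m) (hS1 : Ideal.span (Set.range S) = ⊤)
    (hT1 : Ideal.span (Set.range T) = ⊤) (hST : ∀ i j, S i * T j = S j * T i) : n = m :=
  le_antisymm (hS.le hT hS1 hT1 hST)
    (hT.le hS hT1 hS1 fun i j ↦ by linear_combination -hST i j)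

/-- The coefficients of `(a X + b) (c X + d)`. -/
def sym2 {R : Type*} [CommRing R] (a b c d : R) : Fin 3 → R := ![a * c, a * d + b * c, b * d]

lemma sym2_ne_zero {k : Type*} [Field k] {a b c d : k} (h : a ≠ 0 ∨ b ≠ 0) (h' : c ≠ 0 ∨ d ≠ 0) :
    sym2 a b c d ≠ 0 := by
  intro h0
  have h1 : a * c = 0 := congrFun h0 0
  have h2 : a * d + b * c = 0 := congrFun h0 1
  have h3 : b * d = 0 := congrFun h0 2
  grind

/-- Gauss's lemma: modulo a maximal ideal, a product of two nonzero linear forms is nonzero. -/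
lemma span_sym2 {a b c d : F[X]} (h : IsCoprime a b) (h' : IsCoprime c d) :
    Ideal.span (Set.range (sym2 a b c d)) = ⊤ := by
  by_contra hne
  obtain ⟨M, hM, hle⟩ := Ideal.exists_le_maximal _ hne
  have hmem (i) : sym2 a b c d i ∈ M := hle (Ideal.subset_span ⟨i, rfl⟩)
  have h1 : a * c ∈ M := hmem 0
  have h2 : a * d + b * c ∈ M := hmem 1
  have h3 : b * d ∈ M := hmem 2
  have key {x y : F[X]} (hxy : IsCoprime x y) (hx : x ∈ M) (hy : y ∈ M) : False := by
    obtain ⟨s, t, hst⟩ := hxy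
    exact hM.ne_top ((Ideal.eq_top_iff_one M).2
      (hst ▸ add_mem (M.mul_mem_left s hx) (M.mul_mem_left t hy)))
  rcases hM.isPrime.mem_or_mem h1 with ha | hc
  · have hbc : b * c ∈ M := (add_mem_cancel_left (M.mul_mem_right d ha)).1 h2
    rcases hM.isPrime.mem_or_mem hbc with hb | hc
    · exact key h ha hb
    · rcases hM.isPrime.mem_or_mem h3 with hb | hd
      exacts [key h ha hb, key h' hc hd]
  · have had : a * d ∈ M := (add_mem_cancel_right (M.mul_mem_left b hc)).1 h2
    rcases hM.isPrime.mem_or_mem had with ha | hd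
    · rcases hM.isPrime.mem_or_mem h3 with hb | hd
      exacts [key h ha hb, key h' hc hd]
    · exact key h' hc hd

lemma isTopDegree_pair {a b : F[X]} {n : ℕ} :
    IsTopDegree ![a, b] n ↔
      (a.natDegree ≤ n ∧ b.natDegree ≤ n) ∧ (a.coeff n ≠ 0 ∨ b.coeff n ≠ 0) := by
  simp [IsTopDegree, Fin.forall_fin_two, Fin.exists_fin_two]

/-- The coefficients in degree `n + m` are `sym2` of the top coefficients, hence not all zero. -/
lemma IsTopDegree.sym2 {a b c d : F[X]} {n m : ℕ} (h : IsTopDegree ![a, b] n)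
    (h' : IsTopDegree ![c, d] m) : IsTopDegree (sym2 a b c d) (n + m) := by
  rw [isTopDegree_pair] at h h'
  obtain ⟨⟨ha, hb⟩, hab⟩ := h
  obtain ⟨⟨hc, hd⟩, hcd⟩ := h'
  refine ⟨fun i ↦ ?_, ?_⟩
  · fin_cases i
    · exact natDegree_mul_le_of_le ha hc
    · exact natDegree_add_le_of_degree_le (natDegree_mul_le_of_le ha hd)
        (natDegree_mul_le_of_le hb hc)
    · exact natDegree_mul_le_of_le hb hd
  · obtain ⟨i, hi⟩ := Function.ne_iff.1 (sym2_ne_zero hab hcd)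
    refine ⟨i, ?_⟩
    fin_cases i
    · simpa [EllipticIsogeny.sym2, coeff_mul_add_eq_of_natDegree_le ha hc] using hi
    · simpa [EllipticIsogeny.sym2, coeff_mul_add_eq_of_natDegree_le ha hd,
        coeff_mul_add_eq_of_natDegree_le hb hc] using hi
    · simpa [EllipticIsogeny.sym2, coeff_mul_add_eq_of_natDegree_le hb hd] using hi

variable (W : WeierstrassCurve F)

/-- The map `addSubMap` on triples of polynomials. -/
def addSubPoly (S : Fin 3 → F[X]) (i : Fin 3) : F[X] := (addSubMap (W.map C) i).eval S

lemma addSubMap_map_eval {R R' : Type*} [CommRing R] [CommRing R'] (f : R →+* R')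
    (V : WeierstrassCurve R) (S : Fin 3 → R) (i : Fin 3) :
    (addSubMap (V.map f) i).eval (fun j ↦ f (S j)) = f ((addSubMap V i).eval S) := by
  have h1 : S = ![S 0, S 1, S 2] := by ext i; fin_cases i <;> rfl
  have h2 : (fun j ↦ f (S j)) = ![f (S 0), f (S 1), f (S 2)] := by ext i; fin_cases i <;> rfl
  rw [h2, addSubMap_eval, h1, addSubMap_eval]
  fin_cases i <;> simp [map_ofNat]

/-- By `addSubMapCoeff_condition`, each `S i ^ 4` is a combination of the values of the quadratic
forms, and fourth powers of generators of the unit ideal still generate it. -/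
lemma span_addSubPoly [W.IsElliptic] {S : Fin 3 → F[X]} (hS : Ideal.span (Set.range S) = ⊤) :
    Ideal.span (Set.range (addSubPoly W S)) = ⊤ := by
  rw [eq_top_iff, ← Ideal.span_pow_eq_top _ hS 4, Ideal.span_le]
  rintro _ ⟨_, ⟨i, rfl⟩, rfl⟩
  simp only
  rw [← addSubMapCoeff_condition (W.map C) S i]
  exact sum_mem fun j _ ↦ Ideal.mul_mem_left _ _ (Ideal.subset_span ⟨j, rfl⟩)

/-- The forms are quadratic, and on the vector of top coefficients they do not all vanish, by
`addSubMap_ne_zero`; so the degree doubles exactly. -/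
lemma IsTopDegree.addSubPoly [W.IsElliptic] {S : Fin 3 → F[X]} {n : ℕ} (hS : IsTopDegree S n) :
    IsTopDegree (addSubPoly W S) (2 * n) := by
  obtain ⟨hdeg, i₀, hi₀⟩ := hS
  have hmul (i j : Fin 3) : (S i * S j).natDegree ≤ 2 * n :=
    (natDegree_mul_le_of_le (hdeg i) (hdeg j)).trans (by omega)
  have hcoeff (i j : Fin 3) : (S i * S j).coeff (2 * n) = (S i).coeff n * (S j).coeff n := by
    rw [two_mul, coeff_mul_add_eq_of_natDegree_le (hdeg i) (hdeg j)]
  have hC (c : F) (i j : Fin 3) : (C c * (S i * S j)).natDegree ≤ 2 * n :=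
    (natDegree_C_mul_le _ _).trans (hmul i j)
  have hsub {f g : F[X]} (hf : f.natDegree ≤ 2 * n) (hg : g.natDegree ≤ 2 * n) :
      (f - g).natDegree ≤ 2 * n := (natDegree_sub_le f g).trans (max_le hf hg)
  have hS3 : S = ![S 0, S 1, S 2] := by ext i; fin_cases i <;> rfl
  have e0 : EllipticIsogeny.addSubPoly W S 0 = S 0 * S 0 - C W.b₄ * (S 0 * S 2) -
      C W.b₆ * (S 1 * S 2) - C W.b₈ * (S 2 * S 2) := by
    rw [EllipticIsogeny.addSubPoly, hS3, addSubMap_eval]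
    simp
    ring
  have e1 : EllipticIsogeny.addSubPoly W S 1 = C 2 * (S 1 * S 0) + C W.b₂ * (S 0 * S 2) +
      C W.b₄ * (S 1 * S 2) + C W.b₆ * (S 2 * S 2) := by
    rw [EllipticIsogeny.addSubPoly, hS3, addSubMap_eval]
    simp [C_ofNat]
    ring
  have e2 : EllipticIsogeny.addSubPoly W S 2 = S 1 * S 1 - C 4 * (S 0 * S 2) := by
    rw [EllipticIsogeny.addSubPoly, hS3, addSubMap_eval]
    simp [C_ofNat]
    ring
  refine ⟨fun i ↦ ?_, ?_⟩
  · fin_cases i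
    · change (EllipticIsogeny.addSubPoly W S 0).natDegree ≤ _
      rw [e0]
      exact hsub (hsub (hsub (hmul 0 0) (hC _ 0 2)) (hC _ 1 2)) (hC _ 2 2)
    · change (EllipticIsogeny.addSubPoly W S 1).natDegree ≤ _
      rw [e1]
      exact natDegree_add_le_of_degree_le (natDegree_add_le_of_degree_le
        (natDegree_add_le_of_degree_le (hC _ 1 0) (hC _ 0 2)) (hC _ 1 2)) (hC _ 2 2)
    · change (EllipticIsogeny.addSubPoly W S 2).natDegree ≤ _
      rw [e2]
      exact hsub (hmul 1 1) (hC _ 0 2)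
  · have hne := addSubMap_ne_zero W (x := ![(S 0).coeff n, (S 1).coeff n, (S 2).coeff n])
      fun h0 ↦ hi₀ (by
        have := congrFun h0 i₀
        fin_cases i₀ <;> exact this)
    obtain ⟨i, hi⟩ := Function.ne_iff.1 hne
    refine ⟨i, ?_⟩
    rw [addSubMap_eval] at hi
    refine ne_of_eq_of_ne ?_ hi
    fin_cases i
    · change (EllipticIsogeny.addSubPoly W S 0).coeff _ = _
      simp only [e0, coeff_sub, coeff_C_mul, hcoeff, Fin.zero_eta, Matrix.cons_val_zero]
      ring
    · change (EllipticIsogeny.addSubPoly W S 1).coeff _ = _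
      simp only [e1, coeff_add, coeff_C_mul, hcoeff, Fin.mk_one, Matrix.cons_val_one,
        Matrix.cons_val_zero]
      ring
    · change (EllipticIsogeny.addSubPoly W S 2).coeff _ = _
      simp only [e2, coeff_sub, coeff_C_mul, hcoeff, Fin.reduceFinMk, Matrix.cons_val]
      ring

end TopDegree

/-! ### Sums of isogenies. -/

section Sum

variable {F : Type*} [Field F] {E₁ E₂ : WeierstrassCurve F}

/-- Every `R` is a difference of two points `R + P` and `P` at which `γ` vanishes. -/
lemma eq_zero_of_eventually_eq_zero [E₁.IsElliptic] {G : Type*} [AddGroup G]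
    {γ : GeomPoint E₁ →+ G} (h : ∀ᶠ P in cofinite, γ P = 0) : γ = 0 := by
  ext R
  obtain ⟨P, h1, h2⟩ := (h.and ((add_right_injective R).tendsto_cofinite.eventually h)).exists
  simpa [h1] using h2

lemma IsGenericallyGivenBy.neg {α : GeomPoint E₁ →+ GeomPoint E₂} {u v : E₁.toAffine.FunctionField}
    (h : IsGenericallyGivenBy α u v) :
    IsGenericallyGivenBy (-α) u (-v - algebraMap F _ E₂.a₁ * u - algebraMap F _ E₂.a₃) := by
  refine .of_eventually ?_ ?_ ?_
  · filter_upwards [h.eventually_apply_ne_zero] with P hP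
    simpa using hP
  · filter_upwards [h.eventually_xc] with P hP
    rw [hP, AddMonoidHom.neg_apply, xc_neg]
  · filter_upwards [h.eventually_apply_ne_zero, h.eventually_xc, h.eventually_yc,
      eventually_val_sub (-v - algebraMap F _ E₂.a₁ * u) (algebraMap F _ E₂.a₃),
      eventually_val_sub (-v) (algebraMap F _ E₂.a₁ * u), eventually_val_neg v,
      eventually_val_mul (algebraMap F _ E₂.a₁) u, eventually_val_algebraMap (E := E₁) E₂.a₁,
      eventually_val_algebraMap (E := E₁) E₂.a₃] with P h1 h2 h3 h4 h5 h6 h7 h8 h9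
    rw [h4, h5, h6, h7, h8, h9, h2, h3, AddMonoidHom.neg_apply, yc_neg h1]

variable {α β : GeomPoint E₁ →+ GeomPoint E₂} {u₁ v₁ u₂ v₂ : E₁.toAffine.FunctionField}

/-- The slope of the line through two generic points. -/
lemma IsGenericallyGivenBy.exists_slope [E₁.IsElliptic] (hα : IsGenericallyGivenBy α u₁ v₁)
    (hβ : IsGenericallyGivenBy β u₂ v₂)
    (hne : ¬(u₁ = u₂ ∧ v₁ = -v₂ - algebraMap F _ E₂.a₁ * u₂ - algebraMap F _ E₂.a₃)) :
    ∃ l : E₁.toAffine.FunctionField, ∀ᶠ P in cofinite,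
      ¬(xc (α P) = xc (β P) ∧ yc (α P) = (geomCurve E₂).negY (xc (β P)) (yc (β P))) ∧
      val l P = (geomCurve E₂).slope (xc (α P)) (xc (β P)) (yc (α P)) (yc (β P)) := by
  by_cases hu : u₁ = u₂
  · have hv : v₁ - (-v₂ - algebraMap F _ E₂.a₁ * u₂ - algebraMap F _ E₂.a₃) ≠ 0 :=
      sub_ne_zero.2 fun hv ↦ hne ⟨hu, hv⟩
    by_cases hv' : v₁ = v₂
    · subst hu hv'
      set n : E₁.toAffine.FunctionField := 3 * u₁ ^ 2 + 2 * algebraMap F _ E₂.a₂ * u₁ +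
        algebraMap F _ E₂.a₄ - algebraMap F _ E₂.a₁ * v₁ with hn
      refine ⟨n / (v₁ - (-v₁ - algebraMap F _ E₂.a₁ * u₁ - algebraMap F _ E₂.a₃)), ?_⟩
      have hnP : ∀ᶠ P in cofinite, val n P = 3 * val u₁ P ^ 2 +
          2 * algebraMap F _ E₂.a₂ * val u₁ P + algebraMap F _ E₂.a₄ - algebraMap F _ E₂.a₁ * val v₁ P := by
        have := eventually_val_aevalAeval u₁ v₁ (C (C 3 * X ^ 2 + C 2 * C E₂.a₂ * X + C E₂.a₄) -
          C (C E₂.a₁) * Y)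
        simpa only [map_sub, map_add, map_mul, map_pow, aevalAeval_Y, aevalAeval_C, aeval_X,
          aeval_C, map_ofNat] using this
      filter_upwards [eventually_val_div' n _ hv, hnP, hα.neg.eventually_yc, hα.eventually_xc,
        hα.eventually_yc, eventually_val_sub v₁ _, eventually_val_ne_zero hv, hβ.eventually_xc,
        hβ.eventually_yc, hα.eventually_apply_ne_zero] with P h1 h2 h3 h4 h5 h6 h7 h8 h9 h10
      rw [h6, h3, h5, AddMonoidHom.neg_apply, yc_neg h10, sub_ne_zero] at h7
      have hy : yc (α P) ≠ (geomCurve E₂).negY (xc (β P)) (yc (β P)) := by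
        rw [← h8, ← h9, h4, h5]
        exact h7
      refine ⟨fun h ↦ hy h.2, ?_⟩
      rw [slope_of_Y_ne (h4.symm.trans h8) hy, h1, h6, h2, h3, h4, h5, AddMonoidHom.neg_apply,
        yc_neg h10]
      rfl
    -- Equal `x`-coordinates and different `y`-coordinates mean `α P = -β P` for almost all `P`,
    -- which `hne` excludes.
    · exfalso
      subst hu
      refine hne ⟨rfl, eq_of_eventually_val_eq ?_⟩
      filter_upwards [hα.eventually_xc, hα.eventually_yc, hβ.eventually_xc, hβ.eventually_yc,
        hβ.neg.eventually_yc, eventually_val_ne hv', hα.eventually_apply_ne_zero,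
        hβ.eventually_apply_ne_zero] with P h1 h2 h3 h4 h5 h6 h7 h8
      rw [h5, h2, AddMonoidHom.neg_apply]
      have h := (Point.X_eq_iff (h₁ := nonsingular_of_ne_zero h7)
        (h₂ := nonsingular_of_ne_zero h8)).1 (h1.symm.trans h3)
      rw [← eq_some_of_ne_zero h7, ← eq_some_of_ne_zero h8] at h
      rcases h with h | h
      · rw [h2, h4, h] at h6
        exact absurd rfl h6
      · rw [h]
  · refine ⟨(v₁ - v₂) / (u₁ - u₂), ?_⟩
    filter_upwards [eventually_val_div' (v₁ - v₂) _ (sub_ne_zero.2 hu), eventually_val_ne hu,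
      eventually_val_sub v₁ v₂, eventually_val_sub u₁ u₂, hα.eventually_xc, hα.eventually_yc,
      hβ.eventually_xc, hβ.eventually_yc] with P h1 h2 h3 h4 h5 h6 h7 h8
    rw [h5, h7] at h2
    refine ⟨fun h ↦ h2 h.1, ?_⟩
    rw [slope_of_X_ne h2, h1, h3, h4, h5, h6, h7, h8]

lemma IsGenericallyGivenBy.add [E₁.IsElliptic] (hα : IsGenericallyGivenBy α u₁ v₁)
    (hβ : IsGenericallyGivenBy β u₂ v₂)
    (hne : ¬(u₁ = u₂ ∧ v₁ = -v₂ - algebraMap F _ E₂.a₁ * u₂ - algebraMap F _ E₂.a₃)) :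
    ∃ u v, IsGenericallyGivenBy (α + β) u v := by
  obtain ⟨l, hl⟩ := hα.exists_slope hβ hne
  -- The chord-tangent formula `l² + a₁ l - a₂ - (u₁ + u₂)`, written as one bivariate polynomial so
  -- that a single evaluation lemma applies.
  set u := aevalAeval l (u₁ + u₂) (C (X ^ 2 + C E₂.a₁ * X - C E₂.a₂) - Y : F[X][Y]) with hu
  set w := l * (u - u₁) + v₁ with hw
  set v := aevalAeval u w (C (- C E₂.a₁ * X - C E₂.a₃) - Y : F[X][Y]) with hv
  have key : ∀ᶠ P in cofinite, α P + β P ≠ 0 ∧ val u P = xc (α P + β P) ∧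
      val v P = yc (α P + β P) := by
    filter_upwards [hl, hα.eventually_xc, hα.eventually_yc, hβ.eventually_xc, hβ.eventually_yc,
      hα.eventually_apply_ne_zero, hβ.eventually_apply_ne_zero,
      eventually_val_aevalAeval l (u₁ + u₂) (C (X ^ 2 + C E₂.a₁ * X - C E₂.a₂) - Y : F[X][Y]),
      eventually_val_aevalAeval u w (C (- C E₂.a₁ * X - C E₂.a₃) - Y : F[X][Y]),
      eventually_val_add u₁ u₂, eventually_val_add (l * (u - u₁)) v₁,
      eventually_val_mul l (u - u₁), eventually_val_sub u u₁]
      with P ⟨h1, h2⟩ h3 h4 h5 h6 h7 h8 h9 h10 h11 h12 h13 h14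
    have hsum := Point.add_some (h₁ := nonsingular_of_ne_zero h7)
      (h₂ := nonsingular_of_ne_zero h8) h1
    rw [← eq_some_of_ne_zero h7, ← eq_some_of_ne_zero h8] at hsum
    simp only [map_sub, map_add, map_mul, map_pow, map_neg, aevalAeval_Y, aevalAeval_C, aeval_X,
      aeval_C] at h9 h10
    have hx : val u P = xc (α P + β P) := by
      rw [hu, map_sub, aevalAeval_C, aevalAeval_Y]
      simp only [map_sub, map_add, map_mul, map_pow, aeval_X, aeval_C]
      rw [h9, hsum, xc_some, h11, h2, h3, h5]
      simp only [addX, geomCurve, toAffine, map_a₁, map_a₂]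
      ring
    refine ⟨hsum ▸ Point.some_ne_zero _, hx, ?_⟩
    rw [hsum, xc_some] at hx
    rw [hv, map_sub, aevalAeval_C, aevalAeval_Y]
    simp only [map_sub, map_mul, map_neg, aeval_X, aeval_C]
    rw [h10, hw, h12, h13, h14, hsum, yc_some, h2, h3, h4, hx]
    simp only [addY, negY, negAddY, geomCurve, toAffine, map_a₁, map_a₃]
    ring
  exact ⟨u, v, .of_eventually (key.mono fun _ h ↦ h.1) (key.mono fun _ h ↦ h.2.1)
    (key.mono fun _ h ↦ h.2.2)⟩

lemma IsGenericallyGivenBy.add_eq_zero [E₁.IsElliptic] (hβ : IsGenericallyGivenBy β u₂ v₂)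
    (hα : IsGenericallyGivenBy α u₂ (-v₂ - algebraMap F _ E₂.a₁ * u₂ - algebraMap F _ E₂.a₃)) :
    α + β = 0 := by
  apply eq_zero_of_eventually_eq_zero
  filter_upwards [hα, hβ.neg] with P ⟨_, h1⟩ ⟨_, h2⟩
  rw [AddMonoidHom.add_apply, h1, ← h2, AddMonoidHom.neg_apply, neg_add_cancel]

/-- A homomorphism of groups of geometric points is regular if it is zero or an isogeny. -/
def IsRegular (α : GeomPoint E₁ →+ GeomPoint E₂) : Prop := α = 0 ∨ IsIsogeny α

lemma IsIsogeny.isRegular (hα : IsIsogeny α) : IsRegular α := Or.inr hα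

lemma IsRegular.neg (hα : IsRegular α) : IsRegular (-α) := by
  rcases hα with rfl | hα
  · exact Or.inl (by ext P; simp)
  · obtain ⟨u, v, h⟩ := isIsogeny_iff.1 hα
    exact (isIsogeny_iff.2 ⟨_, _, h.neg⟩).isRegular

lemma IsRegular.add [E₁.IsElliptic] (hα : IsRegular α) (hβ : IsRegular β) : IsRegular (α + β) := by
  rcases hα with rfl | hα
  · have h0 : 0 + β = β := by ext P; simp
    rwa [h0]
  rcases hβ with rfl | hβ
  · have h0 : α + 0 = α := by ext P; simp
    rw [h0]
    exact hα.isRegular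
  obtain ⟨u₁, v₁, h₁⟩ := isIsogeny_iff.1 hα
  obtain ⟨u₂, v₂, h₂⟩ := isIsogeny_iff.1 hβ
  by_cases hne : u₁ = u₂ ∧ v₁ = -v₂ - algebraMap F _ E₂.a₁ * u₂ - algebraMap F _ E₂.a₃
  · obtain ⟨rfl, rfl⟩ := hne
    exact Or.inl (h₂.add_eq_zero h₁)
  · exact (isIsogeny_iff.2 (h₁.add h₂ hne)).isRegular

end Sum

/-! ### The parallelogram law for the degree. -/

section XRep

variable {F : Type*} [Field F] {E₁ E₂ : WeierstrassCurve F} {α β : GeomPoint E₁ →+ GeomPoint E₂}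

/-- The map `α` is described on `x`-coordinates by the fraction `a / b` in lowest terms. -/
def IsXRep (α : GeomPoint E₁ →+ GeomPoint E₂) (a b : F[X]) : Prop :=
  IsCoprime a b ∧
    ∀ᶠ P in cofinite, (α P).xRep 0 * aeval (xc P) b = (α P).xRep 1 * aeval (xc P) a

lemma xRep_of_ne_zero {P : GeomPoint E₁} (hP : P ≠ 0) : P.xRep = ![xc P, 1] := by
  cases P with
  | zero => exact absurd rfl hP
  | some x y h => rfl

lemma IsGenericallyGivenBy.isXRep [E₁.IsElliptic] {v : E₁.toAffine.FunctionField} {r : RatFunc F}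
    (h : IsGenericallyGivenBy α (ratFF E₁ r) v) : IsXRep α r.num r.denom := by
  refine ⟨r.isCoprime_num_denom, ?_⟩
  filter_upwards [h.eventually_xc, eventually_val_ratFF (E := E₁) r, h.eventually_apply_ne_zero,
    eventually_aeval_xc_ne_zero r.denom_ne_zero] with P h1 h2 h3 h4
  rw [xRep_of_ne_zero h3, ← h1, h2]
  simp [h4]

lemma span_pair {a b : F[X]} (h : IsCoprime a b) : Ideal.span (Set.range ![a, b]) = ⊤ := by
  rw [Matrix.range_cons, Matrix.range_cons, Matrix.range_empty, Set.union_empty,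
    Set.singleton_union]
  obtain ⟨s, t, hst⟩ := h
  exact (Ideal.eq_top_iff_one _).2 (Ideal.mem_span_pair.2 ⟨s, t, hst⟩)

lemma eq_zero_of_eventually_aeval [E₁.IsElliptic] {f : F[X]}
    (h : ∀ᶠ P : GeomPoint E₁ in cofinite, aeval (xc P) f = 0) : f = 0 := by
  by_contra h0
  obtain ⟨P, h1, h2⟩ := (h.and (eventually_aeval_xc_ne_zero h0)).exists
  exact h2 h1

/-- The nonzero vector `(α P).xRep` satisfies both linear relations, so their determinant vanishes
at almost all `P`. -/
lemma IsXRep.mul_eq [E₁.IsElliptic] {a b a' b' : F[X]} (h : IsXRep α a b) (h' : IsXRep α a' b') :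
    a * b' = a' * b := by
  rw [← sub_eq_zero]
  apply eq_zero_of_eventually_aeval (E₁ := E₁)
  filter_upwards [h.2, h'.2] with P h1 h2
  have h3 := Point.xRep_ne_zero (α P)
  rw [map_sub, map_mul, map_mul]
  by_contra h0
  apply h3
  ext i
  fin_cases i
  · refine (mul_eq_zero.1 (?_ : (α P).xRep 0 * _ = 0)).resolve_right h0
    linear_combination (aeval (xc P) a) * h2 - (aeval (xc P) a') * h1
  · refine (mul_eq_zero.1 (?_ : (α P).xRep 1 * _ = 0)).resolve_right h0
    linear_combination (aeval (xc P) b) * h2 - (aeval (xc P) b') * h1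

lemma addSubMap_eval_mul {R : Type*} [CommRing R] (W : WeierstrassCurve R) (e : R)
    (S : Fin 3 → R) (i : Fin 3) :
    (addSubMap W i).eval (fun j ↦ e * S j) = e ^ 2 * (addSubMap W i).eval S := by
  have h1 : S = ![S 0, S 1, S 2] := by ext i; fin_cases i <;> rfl
  have h2 : (fun j ↦ e * S j) = ![e * S 0, e * S 1, e * S 2] := by ext i; fin_cases i <;> rfl
  rw [h2, addSubMap_eval, h1, addSubMap_eval]
  fin_cases i <;> simp <;> ring

lemma exists_eq_mul_xRep {E : WeierstrassCurve F} {R : GeomPoint E} {x : AlgebraicClosure F}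
    {a b : F[X]} (hab : IsCoprime a b) (hR : R.xRep 0 * aeval x b = R.xRep 1 * aeval x a) :
    ∃ e : AlgebraicClosure F, e ≠ 0 ∧ aeval x a = e * R.xRep 0 ∧ aeval x b = e * R.xRep 1 := by
  have hne : ¬(aeval x a = 0 ∧ aeval x b = 0) := by
    rintro ⟨ha, hb⟩
    obtain ⟨s, t, hst⟩ := hab
    have := congrArg (aeval x) hst
    simp [ha, hb] at this
  by_cases hR0 : R = 0
  · subst hR0
    simp only [Point.xRep_zero, Matrix.cons_val_zero, Matrix.cons_val_one, one_mul, zero_mul] at *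
    exact ⟨aeval x a, fun h ↦ hne ⟨h, hR⟩, by simp, by simpa using hR⟩
  · rw [xRep_of_ne_zero hR0] at *
    simp only [Matrix.cons_val_zero, Matrix.cons_val_one, one_mul] at *
    refine ⟨aeval x b, fun h ↦ hne ⟨?_, h⟩, by rw [← hR, mul_comm], by simp⟩
    rw [← hR, h, mul_zero]

lemma aeval_addSubPoly {A : Type*} [CommRing A] [Algebra F A] (W : WeierstrassCurve F) (x : A)
    (S : Fin 3 → F[X]) (i : Fin 3) : aeval x (addSubPoly W S i) =
      (addSubMap (W.map (algebraMap F A)) i).eval fun j ↦ aeval x (S j) := by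
  have h := addSubMap_map_eval (aeval x : F[X] →ₐ[F] A).toRingHom (W.map C) S i
  have hW : (W.map C).map (aeval x : F[X] →ₐ[F] A).toRingHom = W.map (algebraMap F A) := by
    ext <;> simp
  rw [hW] at h
  exact h.symm

variable [E₁.IsElliptic] [E₂.IsElliptic]

lemma IsRegular.exists_isXRep (h2 : (2 : F) ≠ 0) (h : IsRegular α) :
    ∃ a b, IsXRep α a b ∧ IsTopDegree ![a, b] (degree α) := by
  rcases h with rfl | h
  -- The zero map has constant `x`-coordinate infinity, represented by `1 / 0` of degree `0`.
  · refine ⟨1, 0, ⟨isCoprime_one_left, .of_forall fun P ↦ ?_⟩, ?_⟩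
    · simp
    · rw [degree_zero, isTopDegree_pair]
      simp
  · obtain ⟨u, v, h⟩ := isIsogeny_iff.1 h
    obtain ⟨r, rfl⟩ := h.exists_eq_ratFF h2
    refine ⟨_, _, h.isXRep, ?_⟩
    rw [isTopDegree_pair, h.degree_eq h2]
    refine ⟨⟨le_max_left _ _, le_max_right _ _⟩, ?_⟩
    have hd : r.denom.coeff r.denom.natDegree ≠ 0 := leadingCoeff_ne_zero.2 r.denom_ne_zero
    rcases le_total r.denom.natDegree r.num.natDegree with he | he
    · rw [max_eq_left he]
      by_cases hr : r = 0
      · subst hr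
        right
        simp
      · exact Or.inl (leadingCoeff_ne_zero.2 (RatFunc.num_ne_zero hr))
    · rw [max_eq_right he]
      exact Or.inr hd

lemma IsRegular.degree_eq (h2 : (2 : F) ≠ 0) (h : IsRegular α) {a b : F[X]} {n : ℕ}
    (hab : IsXRep α a b) (hn : IsTopDegree ![a, b] n) : degree α = n := by
  obtain ⟨a', b', hab', hn'⟩ := h.exists_isXRep h2
  refine hn'.unique hn (span_pair hab'.1) (span_pair hab.1) fun i j ↦ ?_
  have := hab.mul_eq hab'
  fin_cases i <;> fin_cases j
  · rfl
  · change a' * b = b' * a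
    linear_combination -this
  · change b' * a = a' * b
    linear_combination this
  · rfl

/-- The parallelogram law for the degree. -/
theorem IsRegular.degree_add_add_degree_sub (h2 : (2 : F) ≠ 0) (hα : IsRegular α)
    (hβ : IsRegular β) :
    degree (α + β) + degree (α - β) = 2 * (degree α + degree β) := by
  have hsub : IsRegular (α - β) := by
    have : α - β = α + -β := by ext P; simp [sub_eq_add_neg]
    rw [this]
    exact hα.add hβ.neg
  obtain ⟨a₁, b₁, r₁, t₁⟩ := hα.exists_isXRep h2
  obtain ⟨a₂, b₂, r₂, t₂⟩ := hβ.exists_isXRep h2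
  obtain ⟨a₃, b₃, r₃, t₃⟩ := (hα.add hβ).exists_isXRep h2
  obtain ⟨a₄, b₄, r₄, t₄⟩ := hsub.exists_isXRep h2
  -- Both vectors represent the unordered pair `x((α + β) P), x((α - β) P)`; equating their degrees
  -- is the claim, and only proportionality remains to be checked.
  refine (t₃.sym2 t₄).unique ((t₁.sym2 t₂).addSubPoly E₂) (span_sym2 r₃.1 r₄.1)
    (span_addSubPoly E₂ (span_sym2 r₁.1 r₂.1)) fun i j ↦ ?_
  have hprop {P : GeomPoint E₁} {R S : GeomPoint E₂} {a b c d : F[X]}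
      (hab : IsCoprime a b) (hcd : IsCoprime c d)
      (hR : R.xRep 0 * aeval (xc P) b = R.xRep 1 * aeval (xc P) a)
      (hS : S.xRep 0 * aeval (xc P) d = S.xRep 1 * aeval (xc P) c) :
      ∃ e : AlgebraicClosure F, e ≠ 0 ∧ ∀ i, aeval (xc P) (sym2 a b c d i) = e * R.sym2x S i := by
    obtain ⟨e, he, h1, h2⟩ := exists_eq_mul_xRep hab hR
    obtain ⟨e', he', h3, h4⟩ := exists_eq_mul_xRep hcd hS
    refine ⟨e * e', mul_ne_zero he he', fun i ↦ ?_⟩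
    fin_cases i <;> simp [sym2, Point.sym2x, h1, h2, h3, h4] <;> ring
  rw [← sub_eq_zero]
  apply eq_zero_of_eventually_aeval (E₁ := E₁)
  filter_upwards [r₁.2, r₂.2, r₃.2, r₄.2] with P h₁ h₂ h₃ h₄
  obtain ⟨e, he, hS⟩ := hprop r₁.1 r₂.1 h₁ h₂
  obtain ⟨e', he', hT⟩ := hprop r₃.1 r₄.1 h₃ h₄
  obtain ⟨c, hc, hadd⟩ := addSubMap_sym2x (α P) (β P)
  have hA (i) : aeval (xc P) (addSubPoly E₂ (sym2 a₁ b₁ a₂ b₂) i) =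
      e ^ 2 * (c * (α P + β P).sym2x (α P - β P) i) := by
    rw [← hadd, aeval_addSubPoly, ← addSubMap_eval_mul]
    simp only [hS]
  rw [map_sub, map_mul, map_mul, hA, hA, hT, hT]
  simp only [AddMonoidHom.add_apply, AddMonoidHom.sub_apply]
  ring

end XRep

/-! ### Rings with a multiplicative quadratic norm: Cayley–Hamilton and the arithmetic of `r`. -/

section QuadraticNorm

/-- A multiplicative integer-valued function on a ring which satisfies the parallelogram law and
vanishes only at zero. -/
structure IsQuadraticNorm {R : Type*} [Ring R] (D : R → ℤ) : Prop where
  parallelogram : ∀ x y, D (x + y) + D (x - y) = 2 * (D x + D y)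
  map_mul : ∀ x y, D (x * y) = D x * D y
  map_one : D 1 = 1
  eq_zero : ∀ x, D x = 0 → x = 0

namespace IsQuadraticNorm

variable {R : Type*} [Ring R] {D : R → ℤ}

lemma map_zero (hD : IsQuadraticNorm D) : D 0 = 0 := by
  have := hD.parallelogram 0 0
  rw [add_zero, sub_zero] at this
  omega

lemma map_neg (hD : IsQuadraticNorm D) (x : R) : D (-x) = D x := by
  have := hD.parallelogram 0 x
  rw [zero_add, zero_sub, hD.map_zero] at this
  omega

/-- The parallelogram law is a second-order recurrence, so the induction carries two consecutive
values. -/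
lemma map_natCast (hD : IsQuadraticNorm D) (n : ℕ) : D n = n ^ 2 ∧ D (n + 1 : R) = (n + 1) ^ 2 := by
  induction n with
  | zero => simp [hD.map_zero, hD.map_one]
  | succ n ih =>
    have h := hD.parallelogram (n + 1) 1
    rw [add_sub_cancel_right, ih.1, ih.2, hD.map_one] at h
    push_cast
    exact ⟨ih.2, by linear_combination h⟩

lemma map_intCast (hD : IsQuadraticNorm D) (n : ℤ) : D n = n ^ 2 := by
  obtain ⟨m, rfl | rfl⟩ := n.eq_nat_or_neg
  · rw [Int.cast_natCast]
    exact (hD.map_natCast m).1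
  · rw [Int.cast_neg, hD.map_neg, Int.cast_natCast, neg_sq]
    exact (hD.map_natCast m).1

lemma map_zsmul (hD : IsQuadraticNorm D) (n : ℤ) (x : R) : D (n • x) = n ^ 2 * D x := by
  rw [zsmul_eq_mul, hD.map_mul, hD.map_intCast]

lemma zsmul_eq_zero (hD : IsQuadraticNorm D) {n : ℤ} (hn : n ≠ 0) {x : R} (h : n • x = 0) :
    x = 0 := by
  apply hD.eq_zero
  have h1 := hD.map_zsmul n x
  rw [h, hD.map_zero] at h1
  exact (mul_eq_zero.1 h1.symm).resolve_left (pow_ne_zero 2 hn)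

/-- The polar form of `D`. -/
def polar (D : R → ℤ) (x y : R) : ℤ := D (x + y) - D x - D y

lemma polar_comm (x y : R) : polar D x y = polar D y x := by
  rw [polar, polar, add_comm]
  ring

lemma polar_add_left (hD : IsQuadraticNorm D) (x y z : R) :
    polar D (x + y) z = polar D x z + polar D y z := by
  have key (a b : R) : polar D (a + b) z + polar D (a - b) z = 2 * polar D a z := by
    have h1 := hD.parallelogram (a + z) b
    have h2 := hD.parallelogram a b
    rw [show a + z + b = a + b + z by abel, show a + z - b = a - b + z by abel] at h1
    rw [polar, polar, polar]
    linear_combination h1 - h2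
  have key2 (a : R) : polar D (a + a) z = 2 * polar D a z := by
    have h := key a a
    have h0 : polar D 0 z = 0 := by rw [polar, zero_add, hD.map_zero]; ring
    rwa [sub_self, h0, add_zero] at h
  -- As in the Jordan–von Neumann theorem: the sum and difference of these arguments are `2x` and
  -- `2y`.
  have h := key (x + y) (x - y)
  rw [show x + y + (x - y) = x + x by abel, show x + y - (x - y) = y + y by abel, key2, key2] at h
  linarith

lemma polar_add_right (hD : IsQuadraticNorm D) (x y z : R) :
    polar D x (y + z) = polar D x y + polar D x z := by
  rw [polar_comm, hD.polar_add_left, polar_comm y, polar_comm z]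

/-- The polar form as a biadditive map. -/
def polarHom (hD : IsQuadraticNorm D) (z : R) : R →+ ℤ :=
  AddMonoidHom.mk' (fun x ↦ polar D x z) fun x y ↦ hD.polar_add_left x y z

lemma polar_mul_mul (hD : IsQuadraticNorm D) (x y z : R) :
    polar D (x * y) (x * z) = D x * polar D y z := by
  rw [polar, polar, ← mul_add, hD.map_mul, hD.map_mul, hD.map_mul]
  ring

/-- The polarisation of `polar_mul_mul` in its first variable. -/
lemma polar_mul_add_polar_mul (hD : IsQuadraticNorm D) (x w y z : R) :
    polar D (x * y) (w * z) + polar D (w * y) (x * z) = polar D x w * polar D y z := by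
  have h := hD.polar_mul_mul (x + w) y z
  rw [add_mul, add_mul, hD.polar_add_left, hD.polar_add_right, hD.polar_add_right,
    hD.polar_mul_mul, hD.polar_mul_mul] at h
  rw [polar.eq_def D x w]
  linear_combination h

/-- Every element of the ring is a root of its characteristic polynomial. -/
theorem mul_self_eq (hD : IsQuadraticNorm D) (x : R) :
    x * x = (1 + D x - D (1 - x)) • x - D x • (1 : R) := by
  have ht : 1 + D x - D (1 - x) = polar D x 1 := by
    have h := hD.parallelogram 1 x
    rw [hD.map_one] at h
    rw [polar, add_comm x, hD.map_one]
    linear_combination -h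
  rw [ht, ← sub_eq_zero]
  set c := x * x - (polar D x 1 • x - D x • (1 : R)) with hc
  -- The defect `c` is orthogonal to everything. Since `polar D c c = 2 * D c`, this forces `D c =
  -- 0`, hence `c = 0`.
  have hz (z : R) : polar D c z = 0 := by
    have h1 := hD.polar_mul_add_polar_mul x 1 x z
    have h2 := hD.polar_mul_mul x 1 z
    rw [one_mul, one_mul] at h1
    rw [mul_one] at h2
    change hD.polarHom z c = 0
    rw [hc, map_sub, map_sub, _root_.map_zsmul, _root_.map_zsmul, smul_eq_mul, smul_eq_mul]
    change polar D (x * x) z - (polar D x 1 * polar D x z - D x * polar D 1 z) = 0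
    linear_combination h1 - h2
  apply hD.eq_zero
  have h := hz c
  have h4 : D (c + c) = 4 * D c := by
    have := hD.map_zsmul 2 c
    rw [two_zsmul] at this
    rw [this]
    norm_num
  rw [polar, h4] at h
  omega

/-- If `ψ² = ε d π`, `D ψ = d p` and `D π = p²`, then `ψ` satisfies `r ψ = p + ε π` for some integer
`r` which is determined by the trace of `π` up to sign. -/
theorem exists_trace_eq (hD : IsQuadraticNorm D) {p d : ℕ} (hp : p.Prime) (hd : Squarefree d)
    (hpd : ¬ p ∣ d) {ε : ℤ} (hε : ε = 1 ∨ ε = -1) {ψ π : R}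
    (hψ : ψ * ψ = (ε * d : ℤ) * π) (hDψ : D ψ = d * p) (hDπ : D π = p ^ 2) :
    ∃ r : ℤ, 1 + D ψ - D (1 - ψ) = r * d ∧ d * r ^ 2 = 2 * p + ε * (1 + D π - D (1 - π)) ∧
      r * ψ = p + ε * π := by
  rw [← zsmul_eq_mul] at hψ
  have hε2 : ε * ε = 1 := by rcases hε with rfl | rfl <;> rfl
  have hd0 : (d : ℤ) ≠ 0 := Nat.cast_ne_zero.2 hd.ne_zero
  have hp0 : (p : ℤ) ≠ 0 := Nat.cast_ne_zero.2 hp.ne_zero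
  set t := 1 + D ψ - D (1 - ψ)
  set τ := 1 + D π - D (1 - π)
  set β := (p : ℤ) • (1 : R) + ε • π with hβ
  -- Cayley–Hamilton for `ψ`, with `ψ² = ε d π` and `D ψ = d p` inserted.
  have h1 : t • ψ = (d : ℤ) • β := by
    have h : ψ * ψ = t • ψ - D ψ • (1 : R) := hD.mul_self_eq ψ
    rw [hψ, hDψ] at h
    rw [← sub_eq_zero] at h ⊢
    rw [← neg_eq_zero, ← h, hβ]
    module
  have hdt : (d : ℤ) ∣ t := by
    have h2 : t ^ 2 * p = d * D β := by
      have h := congrArg D h1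
      rw [hD.map_zsmul, hD.map_zsmul, hDψ] at h
      apply mul_left_cancel₀ hd0
      linear_combination h
    have h3 : (d : ℤ) ∣ t ^ 2 := by
      refine IsCoprime.dvd_of_dvd_mul_right ?_ (Dvd.intro _ h2.symm)
      exact (Nat.isCoprime_iff_coprime.2 ((hp.coprime_iff_not_dvd.2 hpd).symm))
    exact ((Int.squarefree_natCast.2 hd).dvd_pow_iff_dvd two_ne_zero).1 h3
  obtain ⟨r, hr⟩ := hdt
  have h4 : r • ψ = β := by
    rw [← sub_eq_zero]
    refine hD.zsmul_eq_zero hd0 ?_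
    rw [smul_sub, ← h1, hr, smul_smul, sub_self]
  refine ⟨r, by rw [hr, mul_comm], ?_, by simpa [hβ] using h4⟩
  -- Square `r ψ = β`: the left side is a multiple of `π`, and on the right Cayley–Hamilton for `π`
  -- cancels the constant `p²`.
  have h5 : (r ^ 2 * (ε * d)) • π = (2 * p * ε + τ) • π := by
    have hππ : π * π = τ • π - D π • (1 : R) := hD.mul_self_eq π
    have e1 : (r • ψ) * (r • ψ) = (r ^ 2 * (ε * d)) • π := by
      rw [smul_mul_smul_comm, hψ, smul_smul, sq]
    rw [← e1, h4, hβ]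
    simp only [mul_add, add_mul, smul_mul_assoc, mul_smul_comm, one_mul, mul_one, hππ, hDπ]
    have e2 : (ε * ε) • (τ • π - ((p : ℤ) ^ 2) • (1 : R)) = τ • π - ((p : ℤ) ^ 2) • (1 : R) := by
      rw [hε2, one_smul]
    rw [smul_add, smul_add, smul_smul ε ε, e2]
    module
  have h6 : r ^ 2 * (ε * d) - (2 * p * ε + τ) = 0 := by
    by_contra hne
    have hπ : π = 0 := hD.zsmul_eq_zero hne (by rw [sub_smul, h5, sub_self])
    rw [hπ, hD.map_zero] at hDπ
    exact pow_ne_zero 2 hp0 hDπ.symm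
  linear_combination ε * h6 + (2 * p - r ^ 2 * d) * hε2

end IsQuadraticNorm

end QuadraticNorm

/-! ### The degree as a quadratic norm on the endomorphism ring. -/

section EndomorphismRing

variable {F : Type*} [Field F]

/-- The ring of endomorphisms of `E` defined over `F`. -/
def regularEnd (E : WeierstrassCurve F) [E.IsElliptic] : Subring (AddMonoid.End (GeomPoint E)) where
  carrier := {α | IsRegular (α : GeomPoint E →+ GeomPoint E)}
  zero_mem' := Or.inl rfl
  one_mem' := (isIsogeny_iff.2 ⟨_, _, isGenericallyGivenBy_id⟩).isRegular
  add_mem' hα hβ := IsRegular.add hα hβ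
  neg_mem' hα := IsRegular.neg hα
  mul_mem' {α β} hα hβ := by
    rcases hα with rfl | hα
    · exact Or.inl (zero_mul β)
    rcases hβ with rfl | hβ
    · exact Or.inl (mul_zero α)
    exact (hα.comp hβ).isRegular

variable {E E₂ : WeierstrassCurve F}

lemma isGenericallyGivenBy_pow {α : GeomPoint E →+ GeomPoint E₂} {q : ℕ}
    (h : ∀ P ≠ 0, α P ≠ 0 ∧ xc (α P) = xc P ^ q ∧ yc (α P) = yc P ^ q) :
    IsGenericallyGivenBy α (xFF E ^ q) (yFF E ^ q) := by
  refine .of_eventually ?_ ?_ ?_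
  · exact eventually_ne_zero.mono fun P hP ↦ (h P hP).1
  · filter_upwards [eventually_ne_zero, eventually_val_pow (xFF E) q, eventually_val_xFF]
      with P h1 h2 h3
    rw [h2, h3, (h P h1).2.1]
  · filter_upwards [eventually_ne_zero, eventually_val_pow (yFF E) q, eventually_val_yFF]
      with P h1 h2 h3
    rw [h2, h3, (h P h1).2.2]

variable [E.IsElliptic] [E₂.IsElliptic]

/-- Degree `0` would make the `x`-coordinate of `α` constant, but it is transcendental over `F`. -/
lemma IsIsogeny.degree_ne_zero (h2 : (2 : F) ≠ 0) {α : GeomPoint E →+ GeomPoint E₂}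
    (hα : IsIsogeny α) : degree α ≠ 0 := by
  intro h0
  obtain ⟨a, b, hab, htop⟩ := hα.isRegular.exists_isXRep h2
  obtain ⟨u, v, h⟩ := isIsogeny_iff.1 hα
  obtain ⟨r, rfl⟩ := h.exists_eq_ratFF h2
  rw [h.degree_eq h2] at h0
  obtain ⟨c, rfl⟩ := r.eq_C_iff.2 (Nat.max_eq_zero_iff.1 h0)
  have : ratFF E (RatFunc.C c) = algebraMap F _ c := (ratFF E).commutes c
  refine h.aeval_ne_zero (X_sub_C_ne_zero c) ?_
  rw [map_sub, aeval_X, aeval_C, this, sub_self]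

lemma isQuadraticNorm_degree (h2 : (2 : F) ≠ 0) :
    IsQuadraticNorm fun α : regularEnd E ↦ (degree (α : AddMonoid.End (GeomPoint E)) : ℤ) where
  parallelogram α β := by
    exact_mod_cast IsRegular.degree_add_add_degree_sub h2 α.2 β.2
  map_mul α β := by
    rcases α with ⟨α, rfl | hα⟩
    · rw [← Nat.cast_mul]
      congr 1
      change degree ((0 : AddMonoid.End (GeomPoint E)) * β.1) = degree (0 : _ →+ _) * _
      rw [zero_mul, degree_zero, zero_mul]
      exact degree_zero
    rcases β with ⟨β, rfl | hβ⟩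
    · rw [← Nat.cast_mul]
      congr 1
      change degree (α * (0 : AddMonoid.End (GeomPoint E))) = _ * degree (0 : _ →+ _)
      rw [mul_zero, degree_zero, mul_zero]
      exact degree_zero
    exact_mod_cast degree_comp hα hβ
  map_one := by exact_mod_cast degree_id (E₁ := E)
  eq_zero α h := by
    rcases α with ⟨α, rfl | hα⟩
    · rfl
    · exact absurd (Nat.cast_eq_zero.1 h) (hα.degree_ne_zero h2)

lemma degree_of_pow (h2 : (2 : F) ≠ 0) {α : GeomPoint E →+ GeomPoint E₂} {q : ℕ}
    (h : ∀ P ≠ 0, α P ≠ 0 ∧ xc (α P) = xc P ^ q ∧ yc (α P) = yc P ^ q) :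
    IsIsogeny α ∧ degree α = q := by
  have hα : IsIsogeny α := isIsogeny_iff.2 ⟨_, _, isGenericallyGivenBy_pow h⟩
  refine ⟨hα, hα.isRegular.degree_eq h2 (a := X ^ q) (b := 1) ⟨isCoprime_one_right, ?_⟩ ?_⟩
  · filter_upwards [eventually_ne_zero] with P hP
    rw [xRep_of_ne_zero (h P hP).1, (h P hP).2.1]
    simp
  · rw [isTopDegree_pair]
    simp

end EndomorphismRing

/-! ### Frobenius and the associated endomorphism. -/

section Frobenius

variable (p : ℕ) [Fact p.Prime] {F : Type*} [Field F] [CharP F p]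

lemma frobeniusIsogeny_apply {E E' : WeierstrassCurve F} (h : conjCurve p E = E')
    {P : GeomPoint E} (hP : P ≠ 0) : frobeniusIsogeny p h P ≠ 0 ∧
      xc (frobeniusIsogeny p h P) = xc P ^ p ∧ yc (frobeniusIsogeny p h P) = yc P ^ p := by
  cases P with
  | zero => exact absurd rfl hP
  | some x y hxy => exact ⟨Point.some_ne_zero _, rfl, rfl⟩

lemma frobeniusEnd_apply (hF : Nat.card F = p ^ 2) {E : WeierstrassCurve F}
    {P : GeomPoint E} (hP : P ≠ 0) : frobeniusEnd p hF E P ≠ 0 ∧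
      xc (frobeniusEnd p hF E P) = xc P ^ (p ^ 2) ∧
      yc (frobeniusEnd p hF E P) = yc P ^ (p ^ 2) := by
  cases P with
  | zero => exact absurd rfl hP
  | some x y hxy =>
    exact ⟨Point.some_ne_zero _, iterateFrobenius_def _ _ _, iterateFrobenius_def _ _ _⟩

lemma frobeniusIsogeny_frobeniusIsogeny (hF : Nat.card F = p ^ 2) {E : WeierstrassCurve F}
    (P : GeomPoint E) :
    frobeniusIsogeny p (conjCurve_conjCurve p hF E) (frobeniusIsogeny p rfl P) =
      frobeniusEnd p hF E P := by
  by_cases hP : P = 0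
  · rw [hP, map_zero, map_zero, map_zero]
  obtain ⟨h1, h2, h3⟩ := frobeniusIsogeny_apply p (E := E) rfl hP
  obtain ⟨h4, h5, h6⟩ := frobeniusIsogeny_apply p (conjCurve_conjCurve p hF E) h1
  obtain ⟨h7, h8, h9⟩ := frobeniusEnd_apply p hF hP
  rw [eq_some_of_ne_zero h4, eq_some_of_ne_zero h7, Point.some.injEq, h5, h6, h2, h3, h8, h9, sq,
    pow_mul, pow_mul]
  exact ⟨rfl, rfl⟩

/-- Galois conjugation is conjugation by the `p`-power map on points, so its inverse cancels against
`π_p`. This form needs no separate proof that `σφ` is an isogeny. -/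
lemma associatedEnd_eq_comp (hF : Nat.card F = p ^ 2) {E : WeierstrassCurve F}
    (φ : GeomPoint E →+ GeomPoint (conjCurve p E)) :
    associatedEnd p hF φ =
      (frobeniusIsogeny p (conjCurve_conjCurve p hF E)).comp φ := by
  ext P
  change frobeniusIsogeny p (conjCurve_conjCurve p hF E) (φ (pointMap _ _ (pointMap _ _ P))) =
    frobeniusIsogeny p (conjCurve_conjCurve p hF E) (φ P)
  congr 2
  cases P with
  | zero => rfl
  | some x y h =>
    refine (Point.some.injEq ..).mpr ⟨?_, ?_⟩ <;>
    exact (frobeniusEquiv (AlgebraicClosure F) p).symm_apply_apply _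

lemma associatedEnd_mul_self (hF : Nat.card F = p ^ 2) {E : WeierstrassCurve F} {d : ℕ}
    {φ : GeomPoint E →+ GeomPoint (conjCurve p E)} {ε : ℤ} (hφ : IsAdmissible p hF E d φ ε) :
    associatedEnd p hF φ * associatedEnd p hF φ =
      ((ε * d : ℤ) : AddMonoid.End (GeomPoint E)) * frobeniusEnd p hF E := by
  obtain ⟨φ', ⟨-, -, -, hdual⟩, hconj⟩ := hφ.conj_eq
  rw [hφ.degree_eq] at hdual
  ext P
  have h1 (Q) : associatedEnd p hF φ Q =
      frobeniusIsogeny p (conjCurve_conjCurve p hF E) (φ Q) := by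
    rw [associatedEnd_eq_comp]; rfl
  have h2 : associatedEnd p hF φ P = ε • φ' (frobeniusIsogeny p rfl P) := by
    rw [associatedEnd, hconj]; rfl
  change associatedEnd p hF φ (associatedEnd p hF φ P) =
    ((ε * d : ℤ) : AddMonoid.End (GeomPoint E)) (frobeniusEnd p hF E P)
  rw [AddMonoid.End.intCast_apply]
  -- The outer factor is `π_p ∘ φ` and the inner one `ε φ' ∘ π_p`, so `φ ∘ φ' = d` stands between
  -- two copies of `π_p`.
  rw [h1, h2, map_zsmul, hdual, map_zsmul, map_nsmul, frobeniusIsogeny_frobeniusIsogeny, mul_smul,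
    natCast_zsmul]

end Frobenius

end EllipticIsogeny

end

open EllipticIsogeny in
theorem mainTheorem1 (p : ℕ) [Fact p.Prime] (hp : 3 < p)
    {F : Type*} [Field F] [CharP F p] (hF : Nat.card F = p ^ 2)
    (E : WeierstrassCurve F) [E.IsElliptic] (d : ℕ)
    (φ : GeomPoint E →+ GeomPoint (conjCurve p E)) (ε : ℤ)
    (hφ : IsAdmissible p hF E d φ ε) :
    IsIsogeny (associatedEnd p hF φ) ∧
    associatedEnd p hF φ ^ 2 =
      ((ε * d : ℤ) : AddMonoid.End (GeomPoint E)) * frobeniusEnd p hF E ∧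
    ∃ r : ℤ,
      charpoly (associatedEnd p hF φ) = X ^ 2 - C (r * d) * X + C ((d : ℤ) * p) ∧
      (d : ℤ) * r ^ 2 = 2 * p + ε * frobeniusTrace p hF E ∧
      (r : AddMonoid.End (GeomPoint E)) * associatedEnd p hF φ =
        (p : AddMonoid.End (GeomPoint E)) +
          (ε : AddMonoid.End (GeomPoint E)) * frobeniusEnd p hF E := by
  -- Odd characteristic is what allows degrees to be read from `x`-coordinates.
  have h2 : (2 : F) ≠ 0 := by
    intro h
    have h' : ((2 : ℕ) : F) = 0 := by exact_mod_cast h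
    rw [CharP.cast_eq_zero_iff F p] at h'
    exact absurd (Nat.le_of_dvd two_pos h') (by omega)
  obtain ⟨hπ', hπ'deg⟩ := degree_of_pow h2 fun P hP ↦
    frobeniusIsogeny_apply p (conjCurve_conjCurve p hF E) (P := P) hP
  obtain ⟨hπ, hπdeg⟩ := degree_of_pow h2 fun P hP ↦ frobeniusEnd_apply p hF (E := E) (P := P) hP
  have hψ : IsIsogeny (associatedEnd p hF φ) := by
    rw [associatedEnd_eq_comp]
    exact hπ'.comp hφ.isIsogeny
  have hψdeg : degree (associatedEnd p hF φ) = d * p := by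
    rw [associatedEnd_eq_comp, degree_comp hπ' hφ.isIsogeny, hπ'deg, hφ.degree_eq, mul_comm]
  have hsq := associatedEnd_mul_self p hF hφ
  refine ⟨hψ, by rw [sq, hsq], ?_⟩
  obtain ⟨r, h1, h3, h4⟩ := (isQuadraticNorm_degree (E := E) h2).exists_trace_eq
    (Fact.out : p.Prime) hφ.squarefree hφ.not_dvd hφ.sign
    (ψ := ⟨associatedEnd p hF φ, hψ.isRegular⟩) (π := ⟨frobeniusEnd p hF E, hπ.isRegular⟩)
    (Subtype.ext (by rw [Subring.coe_mul, Subring.coe_mul, Subring.coe_intCast]; exact hsq))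
    (by exact_mod_cast hψdeg) (by exact_mod_cast hπdeg)
  refine ⟨r, ?_, h3, ?_⟩
  · have ht : trace (associatedEnd p hF φ) = r * d := h1
    rw [charpoly, ht, hψdeg, Nat.cast_mul]
  · simpa using congrArg Subtype.val h4
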